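/- For $h\ge 1$ let $Q_h$ be the $h$-cube: its vertices are the binary strings of length $h$, and two of them are adjacent when they differ in exactly one position. Let $G=(V,E)$ be a finite graph and $M\subseteq V$. Vertices $u,v\in V$ are $M$-visible if some shortest $u,v$-path in $G$ contains no vertex of $M\setminus\{u,v\}$. The set $M$ is an outer mutual-visibility set of $G$ if all $u,v\in M$ are $M$-visible and all $u\in M$, $v\in V\setminus M$ are $M$-visible. Let $\mu_o(G)$ denote the cardinality of a largest outer mutual-visibility set of $G$. **Theorem.** $\mu_o(Q_1)=2$, $\mu_o(Q_2)=2$, $\mu_o(Q_3)=4$, $\mu_o(Q_4)=6$, $\mu_o(Q_5)=12$, $\mu_o(Q_6)=24$ and $\mu_o(Q_7)=40$. Moreover, for every $h\ge 8$, $$\binom{h}{\lfloor h/2\rfloor}\le \mu_o(Q_h)\le 40\cdot 2^{h-7}.$$ -/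

import Mathlib

/-- The `h`-cube: vertices are the binary strings of length `h`, two of them being adjacent
when their Hamming distance is one. -/
def hypercubeGraph (h : ℕ) : SimpleGraph (Fin h → Bool) where
  Adj x y := hammingDist x y = 1
  symm := ⟨fun x y hxy => by rw [hammingDist_comm]; exact hxy⟩
  loopless := ⟨fun x hx => by simp at hx⟩

namespace SimpleGraph

variable {V : Type*}

/-- `u` and `v` are `M`-visible in `G`: some shortest `u,v`-path contains no vertex of
`M \ {u, v}`. -/
def MVisible (G : SimpleGraph V) (M : Set V) (u v : V) : Prop :=
  ∃ p : G.Walk u v, p.IsPath ∧ p.length = G.dist u v ∧ ∀ w ∈ p.support, w ∉ M \ {u, v}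

/-- `M` is an outer mutual-visibility set of `G`: all `u, v ∈ M` are `M`-visible, and all
`u ∈ M`, `v ∉ M` are `M`-visible. -/
def IsOuterMutualVisibilitySet (G : SimpleGraph V) (M : Set V) : Prop :=
  (∀ u ∈ M, ∀ v ∈ M, G.MVisible M u v) ∧ (∀ u ∈ M, ∀ v ∈ Mᶜ, G.MVisible M u v)

/-- The outer mutual-visibility number of a finite graph: the cardinality of a largest outer
mutual-visibility set. -/
noncomputable def outerMutualVisibilityNumber [Finite V] (G : SimpleGraph V) : ℕ :=
  sSup {n : ℕ | ∃ M : Set V, G.IsOuterMutualVisibilitySet M ∧ M.ncard = n}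

/-- The supremum in the definition is a maximum. -/
theorem isGreatest_outerMutualVisibilityNumber [Finite V] (G : SimpleGraph V) :
    IsGreatest {n : ℕ | ∃ M : Set V, G.IsOuterMutualVisibilitySet M ∧ M.ncard = n}
      G.outerMutualVisibilityNumber := by
  have hb : BddAbove {n : ℕ | ∃ M : Set V, G.IsOuterMutualVisibilitySet M ∧ M.ncard = n} := by
    refine ⟨Nat.card V, ?_⟩
    rintro n ⟨M, -, rfl⟩
    exact Set.ncard_le_card M
  refine ⟨Nat.sSup_mem ⟨0, ∅, ⟨by simp, by simp⟩, by simp⟩ hb, fun n hn => le_csSup hb hn⟩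

end SimpleGraph

/-!
A set `M` of vertices of the cube is an outer mutual-visibility set if and only if it is locally
visible: whenever `u ∈ M` and `v` is at distance at least two from `u`, some neighbour of `v` that
is closer to `u` lies outside `M` (`locallyVisible_iff`). This condition passes to the two halves of
the cube, hence `μ_o(Q_{h+1}) ≤ 2 μ_o(Q_h)` (`outerMutualVisibilityNumber_succ_le`), and every layer
of the cube satisfies it, hence `μ_o(Q_h)` is at least every binomial coefficient `h.choose k`.
Together with explicit sets in dimensions 1, 3, 5, 6 and 7 this reduces the theorem to the upper
bounds 2, 6 and 40 in dimensions 2, 4 and 7.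

The bounds in dimensions four and seven come from an exhaustive search evaluated by the kernel. Sets
of vertices are bit masks. The search (`search`, with soundness `search_spec`) decides on the lowest
undecided vertex in both ways. It excludes vertices that cannot be added: a vertex with two
neighbours in the set, a neighbour of a member that already has a neighbour in the set, and the
vertex opposite to `z` in a subcube of dimension three or four in which all neighbours of `z` belong
to the set. It stops when the candidates left are too few, where the undecided part of the cube is
cut into blocks of dimension four, which contain at most six members each.

In dimension seven the search goes through the dimensions. Of a set with 41 members in dimension
seven, some half has at least 21 members, some half of that half at least 11, and some half of the
latter at least 6. The sets with so many members in dimensions four, five and six are classified up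
to automorphisms of the cube by searching for the other half above each representative of the
preceding dimension (`EquivalentTo.succ`). There are at most 4, 9 and 27 classes, and above none of
the 27 classes in dimension six is there a set with 41 members (`vertexCount_le_forty`). The
automorphism that takes a set found by the search to its representative is found by trial in
dimensions four and five, and with the help of a table in dimension six.
-/

namespace CubeVisibility

set_option maxRecDepth 100000

/-! ### Outer mutual visibility in a cube as a local condition -/

/-- The local form of outer mutual visibility in the cube: for `u ∈ M` and `v` at distance at
least two from `u`, some neighbour of `v` on a shortest `u,v`-path lies outside `M`. Such a
neighbour arises from `v` by copying one coordinate of `u` in which the two strings differ. -/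
def LocallyVisible {h : ℕ} (M : Set (Fin h → Bool)) : Prop :=
  ∀ u ∈ M, ∀ v, 2 ≤ hammingDist u v → ∃ i, u i ≠ v i ∧ Function.update v i (u i) ∉ M

theorem hammingDist_update {h : ℕ} {u v : Fin h → Bool} {i : Fin h} (hi : u i ≠ v i) :
    hammingDist u (Function.update v i (u i)) + 1 = hammingDist u v := by
  have hs : ({j | u j ≠ v j} : Finset (Fin h)) =
      insert i ({j | u j ≠ Function.update v i (u i) j} : Finset (Fin h)) := by
    ext j
    by_cases hj : j = i
    · subst hj; simp [hi]
    · simp [hj, Function.update_of_ne]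
  unfold hammingDist
  rw [hs, Finset.card_insert_of_notMem (by simp)]

theorem hammingDist_update_right {h : ℕ} {u v : Fin h → Bool} {i : Fin h} (hi : u i ≠ v i) :
    hammingDist (Function.update v i (u i)) v = 1 := by
  unfold hammingDist
  rw [Finset.card_eq_one]
  refine ⟨i, ?_⟩
  ext j
  by_cases hj : j = i
  · subst hj; simp [hi]
  · simp [hj, Function.update_of_ne]

theorem hammingDist_le_length {h : ℕ} {u v : Fin h → Bool} (p : (hypercubeGraph h).Walk u v) :
    hammingDist u v ≤ p.length := by
  induction p with
  | nil => simp
  | @cons a b c hab q ih =>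
    have hab' : hammingDist a b = 1 := hab
    have := hammingDist_triangle a b c
    rw [SimpleGraph.Walk.length_cons]
    omega

theorem exists_walk_length_eq_hammingDist {h : ℕ} (u v : Fin h → Bool) :
    ∃ p : (hypercubeGraph h).Walk u v, p.length = hammingDist u v := by
  induction hd : hammingDist u v generalizing v with
  | zero =>
    obtain rfl := hammingDist_eq_zero.1 hd
    exact ⟨.nil, rfl⟩
  | succ d ih =>
    have hne : u ≠ v := fun e => by simp [e] at hd
    obtain ⟨i, hi⟩ := Function.ne_iff.1 hne
    have h1 := hammingDist_update hi
    obtain ⟨p, hp⟩ := ih (Function.update v i (u i)) (by omega)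
    have hadj : (hypercubeGraph h).Adj (Function.update v i (u i)) v :=
      hammingDist_update_right hi
    exact ⟨p.concat hadj, by rw [SimpleGraph.Walk.length_concat, hp]⟩

theorem dist_hypercubeGraph {h : ℕ} (u v : Fin h → Bool) :
    (hypercubeGraph h).dist u v = hammingDist u v := by
  obtain ⟨p, hp⟩ := exists_walk_length_eq_hammingDist u v
  refine le_antisymm (hp ▸ SimpleGraph.dist_le p) ?_
  obtain ⟨q, hq⟩ := (SimpleGraph.Walk.reachable p).exists_walk_length_eq_dist
  exact hq ▸ hammingDist_le_length q

theorem LocallyVisible.exists_walk {h : ℕ} {M : Set (Fin h → Bool)} (hM : LocallyVisible M)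
    {u : Fin h → Bool} (hu : u ∈ M) (v : Fin h → Bool) :
    ∃ p : (hypercubeGraph h).Walk u v, p.length = hammingDist u v ∧
      ∀ w ∈ p.support, w ∉ M \ {u, v} := by
  induction hd : hammingDist u v generalizing v with
  | zero =>
    obtain rfl := hammingDist_eq_zero.1 hd
    exact ⟨.nil, rfl, by simp⟩
  | succ d ih =>
    rcases Nat.eq_zero_or_pos d with rfl | hpos
    · have hadj : (hypercubeGraph h).Adj u v := hd
      exact ⟨.cons hadj .nil, by simp, by simp⟩
    · obtain ⟨i, hi, hiM⟩ := hM u hu v (by omega)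
      have h1 := hammingDist_update hi
      obtain ⟨p, hp, hpM⟩ := ih (Function.update v i (u i)) (by omega)
      have hadj : (hypercubeGraph h).Adj (Function.update v i (u i)) v :=
        hammingDist_update_right hi
      refine ⟨p.concat hadj, by rw [SimpleGraph.Walk.length_concat, hp], fun w hw => ?_⟩
      rw [SimpleGraph.Walk.support_concat, List.mem_append] at hw
      rcases hw with hw | hw
      · rintro ⟨hwM, hwn⟩
        refine hpM w hw ⟨hwM, ?_⟩
        rintro (rfl | hwe)
        · exact hwn (Or.inl rfl)
        · rw [Set.mem_singleton_iff] at hwe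
          exact hiM (hwe ▸ hwM)
      · rw [List.mem_singleton] at hw
        subst hw
        simp

/-- If `M` is outer mutual-visibility, then `v` is preceded on a visible shortest path by a vertex
outside `M`; conversely such paths are built backwards from `v`, one step at a time. -/
theorem locallyVisible_iff {h : ℕ} {M : Set (Fin h → Bool)} :
    (hypercubeGraph h).IsOuterMutualVisibilitySet M ↔ LocallyVisible M := by
  constructor
  · intro hM u hu v huv
    have hvis : (hypercubeGraph h).MVisible M u v := by
      by_cases hv : v ∈ M
      · exact hM.1 u hu v hv
      · exact hM.2 u hu v hv
    obtain ⟨p, -, hp, hpM⟩ := hvis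
    rw [dist_hypercubeGraph] at hp
    -- The last step of the visible path is read off as the first step of its reverse.
    have hq : p.reverse.length = hammingDist u v := by rw [SimpleGraph.Walk.length_reverse, hp]
    have hqM : ∀ w ∈ p.reverse.support, w ∉ M \ {u, v} := by
      simpa [SimpleGraph.Walk.support_reverse] using hpM
    generalize p.reverse = q at hq hqM
    cases q with
    | nil => simp at huv
    | @cons _ w _ hvw q =>
      have hvw' : hammingDist v w = 1 := hvw
      rw [SimpleGraph.Walk.length_cons] at hq
      have hwu : hammingDist w u ≤ q.length := hammingDist_le_length q
      rw [hammingDist_comm] at hwu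
      have hne : v ≠ w := fun e => by simp [e] at hvw'
      obtain ⟨i, hi⟩ := Function.ne_iff.1 hne
      have hw : w = Function.update v i (w i) := by
        have := hammingDist_update (u := w) (v := v) (i := i) (Ne.symm hi)
        rw [hammingDist_comm w v, hvw'] at this
        exact hammingDist_eq_zero.1 (by omega)
      have hui : u i ≠ v i := by
        intro e
        have := hammingDist_update (u := u) (v := w) (i := i) (by rw [e]; exact hi)
        have hv : Function.update w i (u i) = v := by
          rw [e, hw]; simp
        rw [hv] at this
        omega
      have hwi : w i = u i := by
        revert hi hui; cases u i <;> cases v i <;> cases w i <;> simp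
      refine ⟨i, hui, ?_⟩
      rw [← hwi, ← hw]
      intro hwM
      refine hqM w (by simp) ⟨hwM, ?_⟩
      rintro (rfl | hwv)
      · rw [hammingDist_comm] at hvw'; omega
      · exact hne (Set.mem_singleton_iff.1 hwv).symm
  · intro hM
    have key : ∀ u ∈ M, ∀ v, (hypercubeGraph h).MVisible M u v := by
      intro u hu v
      obtain ⟨p, hp, hpM⟩ := hM.exists_walk hu v
      have hp' : p.length = (hypercubeGraph h).dist u v := by rw [dist_hypercubeGraph, hp]
      exact ⟨p, p.isPath_of_length_eq_dist hp', hp', hpM⟩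
    exact ⟨fun u hu v _ => key u hu v, fun u hu v _ => key u hu v⟩

theorem outerMutualVisibilityNumber_le {h n : ℕ}
    (H : ∀ M : Set (Fin h → Bool), LocallyVisible M → M.ncard ≤ n) :
    (hypercubeGraph h).outerMutualVisibilityNumber ≤ n := by
  obtain ⟨M, hM, hc⟩ := (hypercubeGraph h).isGreatest_outerMutualVisibilityNumber.1
  exact hc ▸ H M (locallyVisible_iff.1 hM)

theorem LocallyVisible.ncard_le {h : ℕ} {M : Set (Fin h → Bool)} (hM : LocallyVisible M) :
    M.ncard ≤ (hypercubeGraph h).outerMutualVisibilityNumber :=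
  (hypercubeGraph h).isGreatest_outerMutualVisibilityNumber.2 ⟨M, locallyVisible_iff.2 hM, rfl⟩

/-! ### Halving a cube -/

theorem LocallyVisible.half {h : ℕ} {M : Set (Fin (h + 1) → Bool)} (hM : LocallyVisible M)
    (b : Bool) :
    LocallyVisible {x : Fin h → Bool | (Fin.cons b x : Fin (h + 1) → Bool) ∈ M} := by
  intro u hu v huv
  have hd : hammingDist (Fin.cons b u : Fin (h + 1) → Bool) (Fin.cons b v) = hammingDist u v := by
    simp [hammingDist, Fin.univ_succ, Finset.filter_insert, Finset.filter_map]
  obtain ⟨i, hi, hiM⟩ := hM _ hu (Fin.cons b v) (hd ▸ huv)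
  induction i using Fin.cases with
  | zero => simp at hi
  | succ i =>
    refine ⟨i, by simpa using hi, ?_⟩
    simpa [Fin.cons_update] using hiM

theorem ncard_eq_add_half {h : ℕ} (M : Set (Fin (h + 1) → Bool)) :
    M.ncard = {x : Fin h → Bool | (Fin.cons false x : Fin (h + 1) → Bool) ∈ M}.ncard +
      {x : Fin h → Bool | (Fin.cons true x : Fin (h + 1) → Bool) ∈ M}.ncard := by
  have hinj : ∀ b : Bool, Function.Injective
      (fun x : Fin h → Bool => (Fin.cons b x : Fin (h + 1) → Bool)) :=
    fun b => Fin.cons_right_injective (α := fun _ => Bool) b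
  rw [← Set.ncard_image_of_injective _ (hinj false), ← Set.ncard_image_of_injective _ (hinj true),
    ← Set.ncard_union_eq]
  · congr 1
    ext x
    simp only [Set.mem_union, Set.mem_image, Set.mem_ofPred_eq]
    constructor
    · intro hx
      rw [← Fin.cons_self_tail x] at hx
      cases hb : x 0
      · exact Or.inl ⟨Fin.tail x, hb ▸ hx, by rw [← hb]; exact Fin.cons_self_tail x⟩
      · exact Or.inr ⟨Fin.tail x, hb ▸ hx, by rw [← hb]; exact Fin.cons_self_tail x⟩
    · rintro (⟨y, hy, rfl⟩ | ⟨y, hy, rfl⟩) <;> exact hy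
  · rw [Set.disjoint_left]
    rintro _ ⟨x, -, rfl⟩ ⟨y, -, hy⟩
    have := congrFun hy 0
    simp at this

theorem outerMutualVisibilityNumber_succ_le (h : ℕ) :
    (hypercubeGraph (h + 1)).outerMutualVisibilityNumber ≤
      2 * (hypercubeGraph h).outerMutualVisibilityNumber := by
  refine outerMutualVisibilityNumber_le fun M hM => ?_
  rw [ncard_eq_add_half, two_mul]
  exact Nat.add_le_add (hM.half false).ncard_le (hM.half true).ncard_le

/-! ### A layer of the cube -/

/-- The strings of weight `k`. From a vertex of the layer one reaches any other vertex by moving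
away from the layer first and returning to it, if at all, in the last step. -/
theorem locallyVisible_layer (h k : ℕ) :
    LocallyVisible {x : Fin h → Bool | (Finset.univ.filter fun i => x i = true).card = k} := by
  intro u hu v huv
  simp only [Set.mem_ofPred_eq] at hu ⊢
  have hup : ∀ i, v i = false → (Finset.univ.filter fun j => Function.update v i true j = true).card
      = (Finset.univ.filter fun j => v j = true).card + 1 := by
    intro i hi
    rw [← Finset.card_insert_of_notMem (a := i) (by simp [hi])]
    congr 1
    ext j
    by_cases hj : j = i
    · subst hj; simp
    · simp [hj]
  have hdown : ∀ i, v i = true →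
      (Finset.univ.filter fun j => Function.update v i false j = true).card + 1
        = (Finset.univ.filter fun j => v j = true).card := by
    intro i hi
    rw [← Finset.card_insert_of_notMem (a := i) (by simp)]
    congr 1
    ext j
    by_cases hj : j = i
    · subst hj; simp [hi]
    · simp [hj]
  by_contra hcon
  push Not at hcon
  -- Every admissible step from `v` lands in the layer, so all steps go in the same direction
  -- and the weights of `u` and `v` differ by one.
  have hdist : hammingDist u v = (Finset.univ.filter fun i => u i = true ∧ v i = false).card +
      (Finset.univ.filter fun i => u i = false ∧ v i = true).card := by
    rw [hammingDist, ← Finset.card_union_of_disjoint]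
    · congr 1
      ext i
      simp only [Finset.mem_filter_univ, Finset.mem_union]
      cases u i <;> cases v i <;> simp
    · rw [Finset.disjoint_filter]
      intro i _ h1 h2
      simp [h1.1] at h2
  have hucard : (Finset.univ.filter fun i => u i = true).card =
      (Finset.univ.filter fun i => u i = true ∧ v i = false).card +
        (Finset.univ.filter fun i => u i = true ∧ v i = true).card := by
    rw [← Finset.card_union_of_disjoint]
    · congr 1
      ext i
      simp only [Finset.mem_filter_univ, Finset.mem_union]
      cases u i <;> cases v i <;> simp
    · rw [Finset.disjoint_filter]
      intro i _ h1 h2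
      simp [h1.2] at h2
  have hvcard : (Finset.univ.filter fun i => v i = true).card =
      (Finset.univ.filter fun i => u i = false ∧ v i = true).card +
        (Finset.univ.filter fun i => u i = true ∧ v i = true).card := by
    rw [← Finset.card_union_of_disjoint]
    · congr 1
      ext i
      simp only [Finset.mem_filter_univ, Finset.mem_union]
      cases u i <;> cases v i <;> simp
    · rw [Finset.disjoint_filter]
      intro i _ h1 h2
      simp [h1.1] at h2
  have h1 : (Finset.univ.filter fun i => u i = true ∧ v i = false).card ≠ 0 →
      (Finset.univ.filter fun j => v j = true).card + 1 = k := by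
    intro hne
    obtain ⟨i, hi⟩ := Finset.card_pos.1 (Nat.pos_of_ne_zero hne)
    rw [Finset.mem_filter_univ] at hi
    have := hcon i (by simp [hi.1, hi.2])
    rw [hi.1, hup i hi.2] at this
    exact this
  have h2 : (Finset.univ.filter fun i => u i = false ∧ v i = true).card ≠ 0 →
      (Finset.univ.filter fun j => v j = true).card = k + 1 := by
    intro hne
    obtain ⟨i, hi⟩ := Finset.card_pos.1 (Nat.pos_of_ne_zero hne)
    rw [Finset.mem_filter_univ] at hi
    have := hcon i (by simp [hi.1, hi.2])
    rw [hi.1] at this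
    have h3 := hdown i hi.2
    omega
  omega

theorem choose_le_outerMutualVisibilityNumber (h k : ℕ) :
    h.choose k ≤ (hypercubeGraph h).outerMutualVisibilityNumber := by
  refine le_trans (le_of_eq ?_) (locallyVisible_layer h k).ncard_le
  have : Set.InjOn (fun s : Finset (Fin h) => fun i => decide (i ∈ s)) Set.univ := by
    intro s _ t _ hst
    ext i
    simpa using congrFun hst i
  have himg : {x : Fin h → Bool | (Finset.univ.filter fun i => x i = true).card = k} =
      (fun s : Finset (Fin h) => fun i => decide (i ∈ s)) ''
        ((Finset.univ : Finset (Fin h)).powersetCard k : Set (Finset (Fin h))) := by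
    ext x
    simp only [Set.mem_ofPred_eq, Set.mem_image, Finset.mem_coe, Finset.mem_powersetCard,
      Finset.subset_univ, true_and]
    constructor
    · intro hx
      exact ⟨_, hx, by ext i; simp⟩
    · rintro ⟨s, hs, rfl⟩
      simpa using hs
  rw [himg, (this.mono (Set.subset_univ _)).ncard_image, Set.ncard_coe_finset,
    Finset.card_powersetCard, Finset.card_univ, Fintype.card_fin]

/-! ### Vertices as natural numbers -/

/-- The vertex of the cube whose coordinates are the lowest `n` binary digits of `x`. -/
def vertex (n x : ℕ) : Fin n → Bool := fun i => x.testBit i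

/-- The number whose binary digits equal to one are exactly those at the places in `l`, provided
that `l` has no repetitions. -/
def xorPow (l : List ℕ) : ℕ := l.foldr (fun i a => 2 ^ i ^^^ a) 0

@[simp] theorem xorPow_nil : xorPow [] = 0 := rfl

@[simp] theorem xorPow_cons (i : ℕ) (l : List ℕ) : xorPow (i :: l) = 2 ^ i ^^^ xorPow l := rfl

theorem testBit_xorPow {l : List ℕ} (hl : l.Nodup) (j : ℕ) :
    (xorPow l).testBit j = decide (j ∈ l) := by
  induction l with
  | nil => simp
  | cons i l ih =>
    rw [List.nodup_cons] at hl
    rw [xorPow_cons, Nat.testBit_xor, ih hl.2, Nat.testBit_two_pow]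
    by_cases hij : i = j
    · subst hij; simp [hl.1]
    · simp [hij, Ne.symm hij]

/-- Local visibility for a set of numbered vertices, using only the first `n` directions: if the
neighbours of `z` in the directions `l` all belong to the set, where `l` has at least two
members, then the vertex obtained from `z` by going along all of `l` does not. -/
def Admissible (n : ℕ) (m : ℕ → Bool) : Prop :=
  ∀ z l, l.Nodup → (∀ i ∈ l, i < n) → 2 ≤ l.length → m (z ^^^ xorPow l) = true →
    ∃ i ∈ l, m (z ^^^ 2 ^ i) = false

theorem Admissible.mono {n k : ℕ} {m : ℕ → Bool} (hm : Admissible n m) (hk : k ≤ n) :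
    Admissible k m :=
  fun z l hl hlk h2 hz => hm z l hl (fun i hi => (hlk i hi).trans_le hk) h2 hz

theorem vertex_injOn (n : ℕ) : Set.InjOn (vertex n) (Finset.range (2 ^ n) : Set ℕ) := by
  intro x hx y hy hxy
  rw [Finset.coe_range, Set.mem_Iio] at hx hy
  refine Nat.eq_of_testBit_eq fun i => ?_
  by_cases hi : i < n
  · exact congrFun hxy ⟨i, hi⟩
  · have h2 : 2 ^ n ≤ 2 ^ i := Nat.pow_le_pow_right two_pos (not_lt.1 hi)
    rw [Nat.testBit_lt_two_pow (hx.trans_le h2), Nat.testBit_lt_two_pow (hy.trans_le h2)]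

theorem exists_vertex_eq {n : ℕ} (v : Fin n → Bool) : ∃ x < 2 ^ n, vertex n x = v :=
  ⟨Nat.ofBits v, Nat.ofBits_lt_two_pow v,
    funext fun i => by simp [vertex, Nat.testBit_ofBits_lt v i i.2]⟩

theorem update_vertex {n : ℕ} (x y : ℕ) (i : Fin n) (h : x.testBit i ≠ y.testBit i) :
    Function.update (vertex n y) i (vertex n x i) = vertex n (y ^^^ 2 ^ (i : ℕ)) := by
  funext j
  by_cases hj : j = i
  · subst hj
    simp only [Function.update_self, vertex, Nat.testBit_xor, Nat.testBit_two_pow_self]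
    revert h; cases x.testBit j <;> cases y.testBit j <;> simp
  · have : (i : ℕ) ≠ j := fun e => hj (Fin.ext e.symm)
    simp [hj, vertex, Nat.testBit_xor, this]

/-- The number of vertices below `N` in the set given by `m`. -/
def vertexCount (m : ℕ → Bool) (N : ℕ) : ℕ := Nat.count (fun x => m x = true) N

theorem ncard_image_vertex (n : ℕ) (m : ℕ → Bool) :
    (vertex n '' {x | x < 2 ^ n ∧ m x = true}).ncard = vertexCount m (2 ^ n) := by
  have : {x | x < 2 ^ n ∧ m x = true} =
      ((Finset.range (2 ^ n)).filter fun x => m x = true : Finset ℕ) := by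
    ext x; simp
  rw [this, vertexCount, Nat.count_eq_card_filter_range, Set.InjOn.ncard_image,
    Set.ncard_coe_finset]
  refine (vertex_injOn n).mono ?_
  rw [Finset.coe_range]
  exact fun x hx => Finset.mem_range.1 (Finset.mem_filter.1 hx).1

theorem ncard_le_of_admissible {n c : ℕ}
    (H : ∀ m, Admissible n m → vertexCount m (2 ^ n) ≤ c) {M : Set (Fin n → Bool)}
    (hM : LocallyVisible M) : M.ncard ≤ c := by
  classical
  have himg : M = vertex n '' {x | x < 2 ^ n ∧ decide (vertex n x ∈ M) = true} := by
    ext v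
    simp only [Set.mem_image, Set.mem_ofPred_eq, decide_eq_true_eq]
    constructor
    · intro hv
      obtain ⟨x, hx, rfl⟩ := exists_vertex_eq v
      exact ⟨x, ⟨hx, hv⟩, rfl⟩
    · rintro ⟨x, ⟨-, hx⟩, rfl⟩
      exact hx
  rw [himg, ncard_image_vertex n fun x => decide (vertex n x ∈ M)]
  refine H _ fun z l hl hln h2 hz => ?_
  rw [decide_eq_true_eq] at hz
  have hbit : ∀ i : ℕ, (z ^^^ xorPow l).testBit i ≠ z.testBit i ↔ i ∈ l := by
    intro i
    rw [Nat.testBit_xor, testBit_xorPow hl]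
    by_cases hi : i ∈ l <;> simp [hi]
  have hdist : hammingDist (vertex n (z ^^^ xorPow l)) (vertex n z) = l.length := by
    rw [← List.toFinset_card_of_nodup hl, hammingDist,
      ← Finset.card_map ⟨fun i : Fin n => (i : ℕ), Fin.val_injective⟩]
    congr 1
    ext i
    simp only [Finset.mem_map, Function.Embedding.coeFn_mk, List.mem_toFinset, vertex]
    constructor
    · rintro ⟨j, hj, rfl⟩
      exact (hbit j).1 (Finset.mem_filter.1 hj).2
    · intro hi
      exact ⟨⟨i, hln i hi⟩, Finset.mem_filter.2 ⟨Finset.mem_univ _, (hbit i).2 hi⟩, rfl⟩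
  obtain ⟨i, hi, hiM⟩ := hM _ hz (vertex n z) (hdist ▸ h2)
  rw [update_vertex _ _ _ hi] at hiM
  exact ⟨i, (hbit i).1 hi, by simpa using hiM⟩

/-- A decidable criterion for the vertices listed by the binary digits of `A` to form a locally
visible set. -/
theorem locallyVisible_image_vertex {n A : ℕ}
    (hA : ∀ x < 2 ^ n, A.testBit x = true → ∀ y < 2 ^ n, y = x ∨ ∃ i < n,
      x.testBit i ≠ y.testBit i ∧ (y ^^^ 2 ^ i = x ∨ A.testBit (y ^^^ 2 ^ i) = false)) :
    LocallyVisible (vertex n '' {x | x < 2 ^ n ∧ A.testBit x = true}) := by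
  rintro _ ⟨x, ⟨hx, hxA⟩, rfl⟩ v huv
  obtain ⟨y, hy, rfl⟩ := exists_vertex_eq v
  rcases hA x hx hxA y hy with rfl | ⟨i, hi, hne, h⟩
  · simp at huv
  · have hup := update_vertex x y ⟨i, hi⟩ hne
    refine ⟨⟨i, hi⟩, hne, ?_⟩
    rw [hup]
    rcases h with h | h
    · have := hammingDist_update (u := vertex n x) (v := vertex n y) (i := ⟨i, hi⟩) hne
      rw [hup, h, hammingDist_self] at this
      omega
    · rintro ⟨w, ⟨hw, hwA⟩, hwe⟩
      have hlt : y ^^^ 2 ^ i < 2 ^ n := Nat.xor_lt_two_pow hy (Nat.pow_lt_pow_right one_lt_two hi)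
      have := vertex_injOn n (by simpa using hw) (by simpa using hlt) hwe
      rw [this, h] at hwA
      exact absurd hwA (by simp)

theorem le_outerMutualVisibilityNumber_of_mask {n A c : ℕ}
    (hA : ∀ x < 2 ^ n, A.testBit x = true → ∀ y < 2 ^ n, y = x ∨ ∃ i < n,
      x.testBit i ≠ y.testBit i ∧ (y ^^^ 2 ^ i = x ∨ A.testBit (y ^^^ 2 ^ i) = false))
    (hc : vertexCount A.testBit (2 ^ n) = c) :
    c ≤ (hypercubeGraph n).outerMutualVisibilityNumber := by
  rw [← hc, ← ncard_image_vertex]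
  exact (locallyVisible_image_vertex hA).ncard_le

/-! ### Automorphisms of the cube -/

/-- The pair `(i, i)` acts on vertices by changing coordinate `i`, and `(i, j)` with `i ≠ j` by
exchanging the coordinates `i` and `j`. -/
def move (g : ℕ × ℕ) (x : ℕ) : ℕ :=
  if g.1 = g.2 then x ^^^ 2 ^ g.1
  else if x.testBit g.1 = x.testBit g.2 then x else x ^^^ 2 ^ g.1 ^^^ 2 ^ g.2

/-- The composition of the moves in a word, the last one being applied first. -/
def moves (w : List (ℕ × ℕ)) (x : ℕ) : ℕ := w.foldr move x

/-- All moves in the word act on the first `n` coordinates only. -/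
def WordBelow (n : ℕ) (w : List (ℕ × ℕ)) : Prop := ∀ g ∈ w, g.1 < n ∧ g.2 < n

theorem WordBelow.mono {n k : ℕ} {w : List (ℕ × ℕ)} (hw : WordBelow n w) (hk : n ≤ k) :
    WordBelow k w :=
  fun g hg => ⟨(hw g hg).1.trans_le hk, (hw g hg).2.trans_le hk⟩

theorem testBit_xor_two_pow (x i j : ℕ) :
    (x ^^^ 2 ^ i).testBit j = (x.testBit j ^^ decide (i = j)) := by
  rw [Nat.testBit_xor, Nat.testBit_two_pow]

theorem move_move (g : ℕ × ℕ) (x : ℕ) : move g (move g x) = x := by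
  obtain ⟨i, j⟩ := g
  by_cases hij : i = j
  · subst hij; simp [move]
  · by_cases hx : x.testBit i = x.testBit j
    · simp [move, hij, hx]
    · have h2 : (x ^^^ 2 ^ i ^^^ 2 ^ j).testBit i ≠ (x ^^^ 2 ^ i ^^^ 2 ^ j).testBit j := by
        simp only [testBit_xor_two_pow, hij, Ne.symm hij]
        revert hx; cases x.testBit i <;> cases x.testBit j <;> simp
      have h3 : move (i, j) x = x ^^^ 2 ^ i ^^^ 2 ^ j := by simp [move, hij, hx]
      rw [h3]
      simp only [move, hij, h2, if_false]
      refine Nat.eq_of_testBit_eq fun k => ?_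
      simp only [testBit_xor_two_pow]
      cases x.testBit k <;> cases decide (i = k) <;> cases decide (j = k) <;> rfl

theorem move_lt {n : ℕ} {g : ℕ × ℕ} (h1 : g.1 < n) (h2 : g.2 < n) {x : ℕ} (hx : x < 2 ^ n) :
    move g x < 2 ^ n := by
  have p1 : 2 ^ g.1 < 2 ^ n := Nat.pow_lt_pow_right one_lt_two h1
  have p2 : 2 ^ g.2 < 2 ^ n := Nat.pow_lt_pow_right one_lt_two h2
  unfold move
  split_ifs
  · exact Nat.xor_lt_two_pow hx p1
  · exact hx
  · exact Nat.xor_lt_two_pow (Nat.xor_lt_two_pow hx p1) p2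

theorem move_xor_two_pow {i j : ℕ} (hij : i ≠ j) (x k : ℕ) :
    move (i, j) (x ^^^ 2 ^ k) = move (i, j) x ^^^ 2 ^ (Equiv.swap i j k) := by
  refine Nat.eq_of_testBit_eq fun t => ?_
  rcases eq_or_ne k i with rfl | hki
  · rw [Equiv.swap_apply_left]
    by_cases hx : x.testBit k = x.testBit j
    · simp only [move, hij, if_false, testBit_xor_two_pow, hx, decide_true]
      simp only [Bool.xor_true, decide_false, Bool.xor_false, Bool.not_eq_eq_eq_not,
        Bool.eq_not_self, if_false, if_true, testBit_xor_two_pow]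
      cases x.testBit t <;> cases decide (k = t) <;> cases decide (j = t) <;> rfl
    · have hx' : (!x.testBit k) = x.testBit j := by
        revert hx; cases x.testBit k <;> cases x.testBit j <;> simp
      simp only [move, hij, if_false, testBit_xor_two_pow, hx, hx', decide_true, Bool.xor_true,
        decide_false, Bool.xor_false, if_true]
      cases x.testBit t <;> cases decide (k = t) <;> cases decide (j = t) <;> rfl
  · rcases eq_or_ne k j with rfl | hkj
    · rw [Equiv.swap_apply_right]
      by_cases hx : x.testBit i = x.testBit k
      · simp only [move, hij, if_false, testBit_xor_two_pow, hx, decide_true, hki]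
        simp only [Bool.xor_true, decide_false, Bool.xor_false,
          Bool.eq_not_self, if_false, if_true, testBit_xor_two_pow]
        cases x.testBit t <;> cases decide (i = t) <;> cases decide (k = t) <;> rfl
      · have hx' : x.testBit i = (!x.testBit k) := by
          revert hx; cases x.testBit i <;> cases x.testBit k <;> simp
        simp only [move, hij, if_false, testBit_xor_two_pow, hx', decide_true, Bool.xor_true, hki,
          decide_false, Bool.xor_false, if_true, Bool.not_eq_self]
        cases x.testBit t <;> cases decide (i = t) <;> cases decide (k = t) <;> rfl
    · rw [Equiv.swap_apply_of_ne_of_ne hki hkj]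
      by_cases hx : x.testBit i = x.testBit j
      · simp [move, hij, hx, hki, hkj]
      · simp only [move, hij, if_false, testBit_xor_two_pow, hx, hki, hkj, decide_false,
          Bool.xor_false]
        cases x.testBit t <;> cases decide (i = t) <;> cases decide (k = t) <;>
          cases decide (j = t) <;> rfl

theorem move_xor_xorPow {i j : ℕ} (hij : i ≠ j) (x : ℕ) (l : List ℕ) :
    move (i, j) (x ^^^ xorPow l) = move (i, j) x ^^^ xorPow (l.map (Equiv.swap i j)) := by
  induction l generalizing x with
  | nil => simp
  | cons k l ih =>
    rw [xorPow_cons, ← Nat.xor_assoc, ih, move_xor_two_pow hij, List.map_cons, xorPow_cons,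
      Nat.xor_assoc]

theorem Admissible.comp_move {n : ℕ} {m : ℕ → Bool} (hm : Admissible n m) {g : ℕ × ℕ}
    (h1 : g.1 < n) (h2 : g.2 < n) : Admissible n (fun x => m (move g x)) := by
  obtain ⟨i, j⟩ := g
  intro z l hl hln hlen hz
  by_cases hij : i = j
  · subst hij
    have hmv : ∀ x, move (i, i) x = x ^^^ 2 ^ i := fun x => by simp [move]
    simp only [hmv] at hz ⊢
    rw [Nat.xor_assoc, Nat.xor_comm (xorPow l), ← Nat.xor_assoc] at hz
    obtain ⟨k, hk, hkz⟩ := hm _ l hl hln hlen hz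
    refine ⟨k, hk, ?_⟩
    rw [Nat.xor_assoc, Nat.xor_comm (2 ^ k), ← Nat.xor_assoc]
    exact hkz
  · simp only [move_xor_xorPow hij] at hz
    obtain ⟨k, hk, hkz⟩ := hm _ (l.map (Equiv.swap i j)) (hl.map (Equiv.injective _))
      (by
        intro k hk
        obtain ⟨t, ht, rfl⟩ := List.mem_map.1 hk
        rcases eq_or_ne t i with rfl | hti
        · rw [Equiv.swap_apply_left]; exact h2
        · rcases eq_or_ne t j with rfl | htj
          · rw [Equiv.swap_apply_right]; exact h1
          · rw [Equiv.swap_apply_of_ne_of_ne hti htj]; exact hln t ht)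
      (by rwa [List.length_map]) hz
    obtain ⟨t, ht, rfl⟩ := List.mem_map.1 hk
    exact ⟨t, ht, by simpa only [move_xor_two_pow hij] using hkz⟩

theorem vertexCount_comp_move (m : ℕ → Bool) {n : ℕ} {g : ℕ × ℕ} (h1 : g.1 < n) (h2 : g.2 < n) :
    vertexCount (fun x => m (move g x)) (2 ^ n) = vertexCount m (2 ^ n) := by
  rw [vertexCount, vertexCount, Nat.count_eq_card_filter_range, Nat.count_eq_card_filter_range]
  refine Finset.card_nbij' (move g) (move g) ?_ ?_ ?_ ?_
  · intro x hx
    simp only [Finset.coe_filter, Finset.mem_range, Set.mem_ofPred_eq] at hx ⊢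
    exact ⟨move_lt h1 h2 hx.1, hx.2⟩
  · intro x hx
    simp only [Finset.coe_filter, Finset.mem_range, Set.mem_ofPred_eq, move_move] at hx ⊢
    exact ⟨move_lt h1 h2 hx.1, hx.2⟩
  · intro x _; exact move_move g x
  · intro x _; exact move_move g x

theorem moves_lt {n : ℕ} {w : List (ℕ × ℕ)} (hw : WordBelow n w) {x : ℕ} (hx : x < 2 ^ n) :
    moves w x < 2 ^ n := by
  induction w with
  | nil => exact hx
  | cons g w ih =>
    rw [WordBelow, List.forall_mem_cons] at hw
    exact move_lt hw.1.1 hw.1.2 (ih hw.2)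

theorem Admissible.comp_moves {n : ℕ} {m : ℕ → Bool} (hm : Admissible n m) {w : List (ℕ × ℕ)}
    (hw : WordBelow n w) : Admissible n (fun x => m (moves w x)) := by
  induction w generalizing m with
  | nil => exact hm
  | cons g w ih =>
    rw [WordBelow, List.forall_mem_cons] at hw
    exact ih (hm.comp_move hw.1.1 hw.1.2) hw.2

theorem vertexCount_comp_moves (m : ℕ → Bool) {n : ℕ} {w : List (ℕ × ℕ)} (hw : WordBelow n w) :
    vertexCount (fun x => m (moves w x)) (2 ^ n) = vertexCount m (2 ^ n) := by
  induction w generalizing m with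
  | nil => rfl
  | cons g w ih =>
    rw [WordBelow, List.forall_mem_cons] at hw
    exact (ih (fun x => m (move g x)) hw.2).trans (vertexCount_comp_move m hw.1.1 hw.1.2)

theorem vertexCount_congr {m m' : ℕ → Bool} {N : ℕ} (h : ∀ x < N, m x = m' x) :
    vertexCount m N = vertexCount m' N := by
  rw [vertexCount, vertexCount, Nat.count_eq_card_filter_range, Nat.count_eq_card_filter_range]
  congr 1
  refine Finset.filter_congr fun x hx => ?_
  rw [h x (Finset.mem_range.1 hx)]

/-! ### Evaluation of binders in the kernel -/

/-- `force n k` is `k n`, written as a recursion on `n`, so that the kernel evaluates `n` to a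
numeral before it enters the body of `k`. -/
noncomputable def force {α : Type} (n : ℕ) (k : ℕ → α) : α :=
  Nat.rec (k 0) (fun m _ => k (Nat.succ m)) n

theorem force_eq {α : Type} (n : ℕ) (k : ℕ → α) : force n k = k n := by
  cases n <;> rfl

/-- A number larger than every bit mask of `128` digits. -/
def mixModulus : ℕ := 0x100000000000000000000000000000033

/-- A unit modulo `mixModulus`. -/
def mixFactor : ℕ := 0x9e3779b97f4a7c15f39cc0605cedc835

/-- The inverse of `mixFactor` modulo `mixModulus`. -/
def unmixFactor : ℕ := 0x945d2b6fe9f7d88b81f96d4a83dcd7be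

theorem unmix_mix {n : ℕ} (hn : n < 2 ^ 128) :
    n * mixFactor % mixModulus * unmixFactor % mixModulus = n := by
  rw [Nat.mod_mul_mod, mul_assoc, ← Nat.mul_mod_mod]
  have h : mixFactor * unmixFactor % mixModulus = 1 := by decide +kernel
  rw [h, mul_one, Nat.mod_eq_of_lt (hn.trans (by decide))]

/-- A variant of `force` returning `z` on `0`. -/
noncomputable def forcePos {α : Type} (n : ℕ) (z : α) (k : ℕ → α) : α :=
  Nat.rec z (fun m _ => k (Nat.succ m)) n

theorem forcePos_eq {α : Type} (n : ℕ) (z : α) (k : ℕ → α) :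
    forcePos n z k = if n = 0 then z else k n := by
  cases n <;> rfl

/-- A variant of `forcePos` for bit masks. The numeral substituted into the body is the mask times
a unit, so that all of its digits are spread over the lowest ones: the kernel caches terms under a
hash that sees only those, and sparse masks would otherwise collide. -/
noncomputable def forceNonempty {α : Type} (n : ℕ) (z : α) (k : ℕ → α) : α :=
  forcePos (Nat.mod (Nat.mul n mixFactor) mixModulus) z fun m =>
    k (Nat.mod (Nat.mul m unmixFactor) mixModulus)

theorem forceNonempty_eq {α : Type} {n : ℕ} (hn : n < 2 ^ 128) (z : α) (k : ℕ → α) :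
    forceNonempty n z k = if n = 0 then z else k n := by
  rw [forceNonempty, forcePos_eq]
  have h : Nat.mod (Nat.mul (Nat.mod (Nat.mul n mixFactor) mixModulus) unmixFactor)
      mixModulus = n := unmix_mix hn
  rw [h]
  by_cases h0 : n = 0
  · subst h0
    rw [if_pos rfl, if_pos (by decide +kernel)]
  · rw [if_neg h0, if_neg]
    intro h1
    rw [h1] at h
    exact h0 (h.symm.trans (by decide +kernel))

/-- A variant of `force` for bit masks, with the same encoding as in `forceNonempty`. -/
noncomputable def forceMask {α : Type} (n : ℕ) (k : ℕ → α) : α := forceNonempty n (k 0) k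

theorem forceMask_eq {α : Type} {n : ℕ} (hn : n < 2 ^ 128) (k : ℕ → α) : forceMask n k = k n := by
  rw [forceMask, forceNonempty_eq hn]
  split_ifs with h0
  · rw [h0]
  · rfl

/-- The conditional expression as a bare recursor. -/
noncomputable def branch {α : Type} (b : Bool) (x y : α) : α := Bool.rec y x b

theorem branch_eq {α : Type} (b : Bool) (x y : α) : branch b x y = if b = true then x else y := by
  cases b <;> rfl

/-! ### Bit masks -/

/-- The mask of the vertices below `128` whose coordinate `i` vanishes. -/
def lowMask (i : ℕ) : ℕ := Nat.div (Nat.sub (Nat.pow 2 128) 1) (Nat.add (Nat.pow 2 (Nat.pow 2 i)) 1)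

/-- The image of a mask under the change of one coordinate, where `lo` is the mask of the vertices
in which this coordinate vanishes and `s` the power of two belonging to it. -/
noncomputable def flipMask (lo s M : ℕ) : ℕ :=
  Nat.lor (Nat.shiftLeft (Nat.land M lo) s) (Nat.land (Nat.shiftRight M s) lo)

/-- `lo` and `s` are the constants to be used in `flipMask` for the coordinate `i`. -/
def FlipData (i lo s : ℕ) : Prop := i < 7 ∧ lo = lowMask i ∧ s = 2 ^ i

theorem testBit_lowMask : ∀ i < 7, ∀ x < 128, (lowMask i).testBit x = !x.testBit i := by
  decide +kernel

theorem lowMask_lt : ∀ i < 7, lowMask i < 2 ^ (128 - 2 ^ i) := by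
  decide +kernel

theorem xor_two_pow_eq : ∀ i < 7, ∀ x < 128,
    x ^^^ 2 ^ i = if x.testBit i then x - 2 ^ i else x + 2 ^ i := by
  decide +kernel

theorem two_pow_le_of_testBit {x i : ℕ} (h : x.testBit i = true) : 2 ^ i ≤ x := by
  by_contra hlt
  rw [Nat.testBit_lt_two_pow (not_le.1 hlt)] at h
  exact absurd h (by simp)

theorem xor_lt {i x : ℕ} (hi : i < 7) (hx : x < 128) : x ^^^ 2 ^ i < 128 :=
  Nat.xor_lt_two_pow (n := 7) hx (Nat.pow_lt_pow_right one_lt_two hi)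

theorem testBit_flipMask {i lo s : ℕ} (h : FlipData i lo s) (M : ℕ) {x : ℕ} (hx : x < 128) :
    (flipMask lo s M).testBit x = M.testBit (x ^^^ 2 ^ i) := by
  obtain ⟨hi, rfl, rfl⟩ := h
  change ((M &&& lowMask i) <<< 2 ^ i ||| M >>> 2 ^ i &&& lowMask i).testBit x = _
  have hlow := testBit_lowMask i hi
  rw [Nat.testBit_or, Nat.testBit_shiftLeft, Nat.testBit_and, Nat.testBit_and,
    Nat.testBit_shiftRight, hlow x hx]
  have hxor := xor_two_pow_eq i hi x hx
  have hbit := testBit_xor_two_pow x i i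
  cases hb : x.testBit i with
  | true =>
    have hle := two_pow_le_of_testBit hb
    rw [hb, if_pos rfl] at hxor
    rw [hb, hxor] at hbit
    rw [hlow _ ((Nat.sub_le _ _).trans_lt hx), hbit, hxor]
    simp [hle]
  | false =>
    rw [hb, if_neg (by simp)] at hxor
    rw [hxor, add_comm x]
    by_cases hle : 2 ^ i ≤ x
    · have h2 : (x - 2 ^ i).testBit i = true := by
        have h3 := testBit_xor_two_pow (x - 2 ^ i) i i
        have h4 := xor_two_pow_eq i hi (x - 2 ^ i) ((Nat.sub_le _ _).trans_lt hx)
        by_contra hf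
        rw [Bool.not_eq_true] at hf
        rw [hf, if_neg (by simp), Nat.sub_add_cancel hle] at h4
        rw [h4, hb, hf] at h3
        simp at h3
      simp [hlow (x - 2 ^ i) ((Nat.sub_le _ _).trans_lt hx), h2]
    · simp [hle]

theorem flipMask_lt {i lo s : ℕ} (h : FlipData i lo s) (M : ℕ) : flipMask lo s M < 2 ^ 128 := by
  obtain ⟨hi, rfl, rfl⟩ := h
  have hlow := lowMask_lt i hi
  have h7 : 2 ^ i < 128 := Nat.pow_lt_pow_right (n := 7) one_lt_two hi
  refine Nat.or_lt_two_pow ?_ ?_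
  · change (M &&& lowMask i) <<< 2 ^ i < _
    have h1 : M &&& lowMask i < 2 ^ (128 - 2 ^ i) := Nat.and_lt_two_pow _ hlow
    rw [Nat.shiftLeft_eq]
    calc (M &&& lowMask i) * 2 ^ 2 ^ i < 2 ^ (128 - 2 ^ i) * 2 ^ 2 ^ i :=
          Nat.mul_lt_mul_of_pos_right h1 (by positivity)
      _ = 2 ^ 128 := by rw [← pow_add, Nat.sub_add_cancel h7.le]
  · exact Nat.and_lt_two_pow _ (hlow.trans_le (Nat.pow_le_pow_right two_pos (Nat.sub_le _ _)))

/-! ### Vertices excluded by a partial set -/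

/-- A list of directions. For each of them the constants `lo` and `s` of `flipMask` and the image
`t` of a fixed mask are kept. -/
inductive Dirs : Type
  | nil : Dirs
  | cons (lo s t : ℕ) (tl : Dirs) : Dirs

/-- The entries of the list belong to the mask `M` and to the directions in `is`. -/
def Dirs.Encodes (M : ℕ) : Dirs → List ℕ → Prop
  | .nil, [] => True
  | .cons lo s t tl, i :: is => FlipData i lo s ∧ t = flipMask lo s M ∧ tl.Encodes M is
  | _, _ => False

/-- The list of directions for the mask `M`, handed to a continuation. -/
noncomputable def withDirs {α : Type} (M : ℕ) (l : List (ℕ × ℕ)) : (Dirs → α) → α :=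
  List.rec (fun k => k Dirs.nil)
    (fun p _ ih k => forceMask (flipMask p.1 p.2 M) fun t =>
      ih fun D => k (Dirs.cons p.1 p.2 t D)) l

/-- Accumulates the vertices with at least one neighbour in the mask, and those with at least
two, and hands them to a continuation. -/
noncomputable def withCounts {α : Type} (D : Dirs) : ℕ → ℕ → (ℕ → ℕ → α) → α :=
  Dirs.rec (fun on tw k => k on tw)
    (fun _ _ t _ ih on tw k =>
      forceMask (Nat.lor tw (Nat.land on t)) fun tw' =>
        forceMask (Nat.lor on t) fun on' => ih on' tw' k) D

/-- The vertices adjacent to a member of `X`. -/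
noncomputable def neighbours (D : Dirs) (X : ℕ) : ℕ :=
  Dirs.rec 0 (fun lo s _ _ ih => Nat.lor (flipMask lo s X) ih) D

/-- Chooses a direction in all possible ways, restricts `X` to the vertices whose neighbour in
that direction lies in the underlying mask, applies `next` to the later directions, and moves the
result along the chosen direction. -/
noncomputable def choose (next : Dirs → ℕ → ℕ) (D : Dirs) (X : ℕ) : ℕ :=
  Dirs.rec 0 (fun lo s t tl ih =>
    Nat.lor (forceNonempty (Nat.land X t) 0 fun y =>
      forceNonempty (next tl y) 0 fun z => flipMask lo s z) ih) D

/-- The members of `X`, and the results of one further choice. -/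
noncomputable def chooseAtMostOne (D : Dirs) (X : ℕ) : ℕ :=
  Nat.lor X (choose (fun _ y => y) D X)

/-- The mask of all vertices of the cube of dimension seven. -/
def fullMask : ℕ := 0xffffffffffffffffffffffffffffffff

/-- The vertices opposite to a vertex `z` in a subcube of dimension three or four all of whose
vertices adjacent to `z` lie in the underlying mask. -/
noncomputable def starMask (D : Dirs) : ℕ := choose (choose (choose chooseAtMostOne)) D fullMask

/-- Hands two masks to a continuation: the vertices with two neighbours in `M` or in
`starMask`, which no admissible set containing `M` contains, and these together with the
neighbours of the members of `M` that have a neighbour in `M`. -/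
noncomputable def withExcluded (l : List (ℕ × ℕ)) (M : ℕ) (k : ℕ → ℕ → Bool) : Bool :=
  withDirs M l fun D => withCounts D 0 0 fun on tw =>
    forceMask (Nat.lor tw (starMask D)) fun f =>
      forceMask (Nat.land M on) fun mt => forceMask (Nat.lor f (neighbours D mt)) fun g => k f g

/-! ### Bounds from subcubes -/

/-- The octal digit number `u` is the size of a largest admissible subset of the set of vertices of
the cube of dimension three with mask `u`. -/
def capTable : ℕ := 0x9249239238da9238db9238da9239238db8da8da8da8da8da9248e38e36da8e369a8e369a8e38e36db6da6da69a6da69192491b91b6da91b6db91b6da91b91b6d26d26da6da6d26919246db6db4926db69a6da4916db6da6d2491492491491448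

/-- The entry of `capTable` at `m`. -/
noncomputable def capEntry (m : ℕ) : ℕ := Nat.land (Nat.shiftRight capTable (Nat.mul 3 m)) 7

/-- A bound for the size of an admissible subset of `U`, summed over `nb` subcubes of dimension
four, each of which contributes at most `cap`. -/
noncomputable def blockBound (cap : ℕ) (nb : ℕ) : ℕ → ℕ :=
  Nat.rec (fun _ => 0) (fun _ ih U =>
    Nat.add (force (Nat.add (capEntry (Nat.land U 255))
        (capEntry (Nat.land (Nat.shiftRight U 8) 255))) fun s => branch (Nat.ble s cap) s cap)
      (forceMask (Nat.shiftRight U 16) ih)) nb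

/-! ### The search -/

/-- Searches for the admissible sets that contain the mask `In`, are contained in the union of
`In` and `c`, and have at least `need` members among the first `16 * nb` vertices; `true` means
that all of them satisfy `k`. It branches on the lowest candidate. -/
noncomputable def extend (l : List (ℕ × ℕ)) (nb cap need : ℕ) (k : ℕ → Bool) (fuel : ℕ) :
    ℕ → ℕ → Bool :=
  Nat.rec (fun _ _ => false) (fun _ ih In c =>
    branch (Nat.ble need (blockBound cap nb (Nat.lor In c)))
      (forceNonempty c (k In) fun c =>
        forceMask (Nat.land c (Nat.sub c 1)) fun c1 =>
        forceMask (Nat.lor In (Nat.xor c c1)) fun In1 =>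
          branch (withExcluded l In1 fun f g =>
            branch (Nat.beq (Nat.land In1 f) 0)
              (forceMask (Nat.xor c1 (Nat.land c1 g)) fun c2 => ih In1 c2) true)
           (ih In c1) false) true) fuel

/-- The search starting from the known part `A` and the candidates `C`. There are never more than
64 candidates, so the fuel suffices; the search would fail if it did not. -/
noncomputable def search (l : List (ℕ × ℕ)) (nb cap need : ℕ) (k : ℕ → Bool) (A C : ℕ) : Bool :=
  withExcluded l A fun _ g =>
    forceMask (Nat.xor C (Nat.land C g)) fun c => extend l nb cap need k 70 A c

/-! ### Soundness of the search -/

theorem two_pow_mul_add_xor {k s : ℕ} (hs : s < 2 ^ k) (a x : ℕ) :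
    (2 ^ k * a + x) ^^^ s = 2 ^ k * a + (x ^^^ s) := by
  have key : ∀ b r, r < 2 ^ k → (2 ^ k * b + r) ^^^ s = 2 ^ k * b + (r ^^^ s) := by
    intro b r hr
    refine Nat.eq_of_testBit_eq fun j => ?_
    rw [Nat.testBit_xor, Nat.testBit_two_pow_mul_add _ hr,
      Nat.testBit_two_pow_mul_add _ (Nat.xor_lt_two_pow hr hs)]
    split_ifs with hj
    · rw [Nat.testBit_xor]
    · rw [Nat.testBit_lt_two_pow (hs.trans_le (Nat.pow_le_pow_right two_pos (not_lt.1 hj))),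
        Bool.xor_false]
  have hr := Nat.mod_lt x (Nat.two_pow_pos k)
  conv_lhs => rw [← Nat.div_add_mod x (2 ^ k), ← add_assoc, ← mul_add, key _ _ hr]
  conv_rhs => rw [← Nat.div_add_mod x (2 ^ k), key _ _ hr]
  rw [mul_add, add_assoc]

theorem xorPow_lt {n : ℕ} {l : List ℕ} (hl : ∀ i ∈ l, i < n) : xorPow l < 2 ^ n := by
  induction l with
  | nil => exact Nat.two_pow_pos n
  | cons i l ih =>
    rw [List.forall_mem_cons] at hl
    exact Nat.xor_lt_two_pow (Nat.pow_lt_pow_right one_lt_two hl.1) (ih hl.2)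

theorem Admissible.shift {n k : ℕ} {m : ℕ → Bool} (hm : Admissible n m) (hn : n ≤ k) (a : ℕ) :
    Admissible n (fun x => m (2 ^ k * a + x)) := by
  intro z l hl hln h2 hz
  have hln' : ∀ i ∈ l, i < k := fun i hi => (hln i hi).trans_le hn
  simp only [← two_pow_mul_add_xor (xorPow_lt hln')] at hz
  obtain ⟨i, hi, h⟩ := hm _ l hl hln h2 hz
  refine ⟨i, hi, ?_⟩
  rw [two_pow_mul_add_xor (Nat.pow_lt_pow_right one_lt_two (hln' i hi))] at h
  exact h

theorem vertexCount_add (m : ℕ → Bool) (a b : ℕ) :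
    vertexCount m (a + b) = vertexCount m a + vertexCount (fun x => m (a + x)) b :=
  Nat.count_add _ _ _

theorem vertexCount_le_capEntry_aux : ∀ s < 256,
    (∀ l ∈ [[0, 1], [0, 2], [1, 2], [0, 1, 2]], ∀ z < 8, s.testBit (z ^^^ xorPow l) = true →
      ∃ i ∈ l, s.testBit (z ^^^ 2 ^ i) = false) →
    ∀ u < 256, s &&& u = s → vertexCount s.testBit 8 ≤ capEntry u := by
  decide +kernel

theorem vertexCount_le_capEntry {m : ℕ → Bool} (hm : Admissible 3 m) {u : ℕ} (hu : u < 256)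
    (hmu : ∀ x < 8, m x = true → u.testBit x = true) : vertexCount m 8 ≤ capEntry u := by
  set s := Nat.ofBits (fun i : Fin 8 => m i) with hs
  have hbit : ∀ x < 8, s.testBit x = m x := fun x hx => Nat.testBit_ofBits_lt _ x hx
  have hslt : s < 256 := Nat.ofBits_lt_two_pow _
  rw [← vertexCount_congr hbit]
  have hlists : ∀ l ∈ [[0, 1], [0, 2], [1, 2], [0, 1, 2]],
      l.Nodup ∧ (∀ i ∈ l, i < 3) ∧ 2 ≤ l.length := by decide
  refine vertexCount_le_capEntry_aux s hslt ?_ u hu ?_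
  · intro l hl z hz h
    have hlp := hlists l hl
    have hlt : z ^^^ xorPow l < 8 := Nat.xor_lt_two_pow (n := 3) hz (xorPow_lt hlp.2.1)
    rw [hbit _ hlt] at h
    obtain ⟨i, hi, hiz⟩ := hm z l hlp.1 hlp.2.1 hlp.2.2 h
    refine ⟨i, hi, ?_⟩
    rw [hbit _ (Nat.xor_lt_two_pow (n := 3) hz
      (Nat.pow_lt_pow_right one_lt_two (hlp.2.1 i hi)))]
    exact hiz
  · refine Nat.eq_of_testBit_eq fun x => ?_
    rw [Nat.testBit_and]
    by_cases hx : x < 8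
    · have := hmu x hx
      rw [← hbit x hx] at this
      revert this
      cases s.testBit x <;> cases u.testBit x <;> simp
    · rw [Nat.testBit_lt_two_pow (hslt.trans_le (Nat.pow_le_pow_right two_pos (not_lt.1 hx)) :
        s < 2 ^ x), Bool.false_and]

theorem blockBound_succ {cap nb U : ℕ} (hU : U < 2 ^ 128) : blockBound cap (nb + 1) U =
    min (capEntry (U % 256) + capEntry (U / 256 % 256)) cap + blockBound cap nb (U / 65536) := by
  change force (capEntry (U &&& 2 ^ 8 - 1) + capEntry ((U >>> 8) &&& 2 ^ 8 - 1))
      (fun s => branch (Nat.ble s cap) s cap) + forceMask (U >>> 16) (blockBound cap nb) = _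
  rw [force_eq, branch_eq, forceMask_eq (by
    rw [Nat.shiftRight_eq_div_pow]; exact (Nat.div_le_self _ _).trans_lt hU),
    Nat.and_two_pow_sub_one_eq_mod, Nat.and_two_pow_sub_one_eq_mod, Nat.shiftRight_eq_div_pow,
    Nat.shiftRight_eq_div_pow, min_def]
  simp only [Nat.ble_eq]

theorem vertexCount_le_blockBound {cap : ℕ}
    (hcap : ∀ m, Admissible 4 m → vertexCount m 16 ≤ cap) (nb : ℕ) :
    ∀ {m : ℕ → Bool} {U : ℕ}, Admissible 4 m → U < 2 ^ 128 →
      (∀ x < 16 * nb, m x = true → U.testBit x = true) →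
      vertexCount m (16 * nb) ≤ blockBound cap nb U := by
  induction nb with
  | zero => intro m U _ _ _; simp [vertexCount]
  | succ nb ih =>
    intro m U hm hU hmU
    rw [blockBound_succ hU, mul_add, mul_one, add_comm, vertexCount_add]
    refine Nat.add_le_add (le_min ?_ (hcap m hm)) ?_
    · rw [show 16 = 8 + 8 from rfl, vertexCount_add]
      have hm3 : Admissible 3 m := hm.mono (by norm_num)
      refine Nat.add_le_add ?_ ?_
      · refine vertexCount_le_capEntry hm3 (Nat.mod_lt _ (by norm_num)) fun x hx h => ?_
        rw [show 256 = 2 ^ 8 from rfl, Nat.testBit_mod_two_pow, hmU x (by omega) h]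
        simp [hx]
      · refine vertexCount_le_capEntry (hm3.shift (k := 3) le_rfl 1)
          (Nat.mod_lt _ (by norm_num)) fun x hx h => ?_
        rw [show 256 = 2 ^ 8 from rfl, Nat.testBit_mod_two_pow, Nat.testBit_div_two_pow,
          add_comm x, hmU (8 + x) (by omega) h]
        simp [hx]
    · refine ih (hm.shift (k := 4) le_rfl 1) ((Nat.div_le_self _ _).trans_lt hU) fun x hx h => ?_
      rw [show 65536 = 2 ^ 16 from rfl, Nat.testBit_div_two_pow, add_comm x]
      exact hmU (16 + x) (by omega) h

theorem exists_clear_lowest {c : ℕ} (hc : c ≠ 0) : ∃ v, c.testBit v = true ∧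
    ∀ x, (c &&& (c - 1)).testBit x = (c.testBit x && decide (x ≠ v)) := by
  obtain ⟨v, q, ⟨p, rfl⟩, rfl⟩ := Nat.exists_eq_two_pow_mul_odd hc
  have h1 : 2 ^ v * (2 * p + 1) = 2 ^ v * (2 * p + 1) + 0 := rfl
  have h2 : 2 ^ v * (2 * p + 1) - 1 = 2 ^ v * (2 * p) + (2 ^ v - 1) := by
    have := Nat.two_pow_pos v
    rw [mul_add, mul_one]; omega
  have hp : 2 ^ v - 1 < 2 ^ v := Nat.sub_lt (Nat.two_pow_pos v) one_pos
  refine ⟨v, ?_, fun x => ?_⟩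
  · rw [h1, Nat.testBit_two_pow_mul_add _ (Nat.two_pow_pos v)]
    simp
  · rw [Nat.testBit_and, h2, Nat.testBit_two_pow_mul_add _ hp, h1,
      Nat.testBit_two_pow_mul_add _ (Nat.two_pow_pos v)]
    by_cases hx : x < v
    · simp [hx]
    · rcases eq_or_ne x v with rfl | hne
      · simp
      · obtain ⟨y, hy⟩ : ∃ y, x - v = y + 1 := ⟨x - v - 1, by omega⟩
        simp only [hx, if_false, hy, Nat.testBit_succ, hne, ne_eq, not_false_eq_true, decide_true,
          Bool.and_true]
        rw [show (2 * p + 1) / 2 = p by omega, show 2 * p / 2 = p by omega, Bool.and_self]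

theorem testBit_eq_false_of_lt {M x : ℕ} (hM : M < 2 ^ 128) (hx : 128 ≤ x) :
    M.testBit x = false :=
  Nat.testBit_lt_two_pow (hM.trans_le (Nat.pow_le_pow_right two_pos hx))

/-- The list of constants for the directions in `is`. -/
def DirData (l : List (ℕ × ℕ)) (is : List ℕ) : Prop :=
  List.Forall₂ (fun p i => FlipData i p.1 p.2) l is

theorem withDirs_eq (M : ℕ) {l : List (ℕ × ℕ)} {is : List ℕ} (h : DirData l is) :
    ∃ D : Dirs, D.Encodes M is ∧ ∀ k : Dirs → Bool, withDirs M l k = k D := by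
  induction h with
  | nil => exact ⟨.nil, trivial, fun k => rfl⟩
  | @cons p i l is hp _ ih =>
    obtain ⟨D, hD, hk⟩ := ih
    refine ⟨.cons p.1 p.2 (flipMask p.1 p.2 M) D, ⟨hp, rfl, hD⟩, fun k => ?_⟩
    change forceMask (flipMask p.1 p.2 M)
      (fun t => withDirs M l fun D => k (Dirs.cons p.1 p.2 t D)) = _
    rw [forceMask_eq (flipMask_lt hp M), hk]

theorem withCounts_eq {M : ℕ} : ∀ {D : Dirs} {is : List ℕ}, D.Encodes M is → is.Nodup →
    ∀ on tw, on < 2 ^ 128 → tw < 2 ^ 128 → ∃ on' tw', tw' < 2 ^ 128 ∧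
      (∀ k : ℕ → ℕ → Bool, withCounts D on tw k = k on' tw') ∧
      (∀ x < 128, on'.testBit x = true →
        on.testBit x = true ∨ ∃ i ∈ is, M.testBit (x ^^^ 2 ^ i) = true) ∧
      (∀ x < 128, tw'.testBit x = true → tw.testBit x = true ∨
        (on.testBit x = true ∧ ∃ i ∈ is, M.testBit (x ^^^ 2 ^ i) = true) ∨
        ∃ i ∈ is, ∃ j ∈ is, i ≠ j ∧ M.testBit (x ^^^ 2 ^ i) = true ∧
          M.testBit (x ^^^ 2 ^ j) = true)
  | .nil, [], _, _, on, tw, _, htw =>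
    ⟨on, tw, htw, fun _ => rfl, fun _ _ h => Or.inl h, fun _ _ h => Or.inl h⟩
  | .cons lo s t tl, i :: is, ⟨hf, ht, htl⟩, hnd, on, tw, hon, htw => by
    have htlt : t < 2 ^ 128 := ht ▸ flipMask_lt hf M
    have htb : ∀ x < 128, t.testBit x = M.testBit (x ^^^ 2 ^ i) :=
      fun x hx => ht ▸ testBit_flipMask hf M hx
    have h1 : on ||| t < 2 ^ 128 := Nat.or_lt_two_pow hon htlt
    have h2 : tw ||| on &&& t < 2 ^ 128 := Nat.or_lt_two_pow htw (Nat.and_lt_two_pow _ htlt)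
    rw [List.nodup_cons] at hnd
    obtain ⟨on', tw', htw', hk, hO, hT⟩ := withCounts_eq htl hnd.2 _ _ h1 h2
    refine ⟨on', tw', htw', fun k => ?_, fun x hx h => ?_, fun x hx h => ?_⟩
    · change forceMask (tw ||| on &&& t)
        (fun tw' => forceMask (on ||| t) fun on' => withCounts tl on' tw' k) = _
      rw [forceMask_eq h2, forceMask_eq h1, hk]
    · rcases hO x hx h with h | ⟨j, hj, h⟩
      · rw [Nat.testBit_or, Bool.or_eq_true, htb x hx] at h
        exact h.imp_right fun h => ⟨i, by simp, h⟩
      · exact Or.inr ⟨j, by simp [hj], h⟩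
    · rcases hT x hx h with h | ⟨h, j, hj, hjx⟩ | ⟨j, hj, j', hj', hne, h, h'⟩
      · rw [Nat.testBit_or, Nat.testBit_and, Bool.or_eq_true, Bool.and_eq_true, htb x hx] at h
        exact h.imp_right fun h => Or.inl ⟨h.1, i, by simp, h.2⟩
      · rw [Nat.testBit_or, Bool.or_eq_true, htb x hx] at h
        rcases h with h | h
        · exact Or.inr (Or.inl ⟨h, j, by simp [hj], hjx⟩)
        · refine Or.inr (Or.inr ⟨i, by simp, j, by simp [hj], ?_, h, hjx⟩)
          rintro rfl
          exact hnd.1 hj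
      · exact Or.inr (Or.inr ⟨j, by simp [hj], j', by simp [hj'], hne, h, h'⟩)

theorem neighbours_spec {M X : ℕ} : ∀ {D : Dirs} {is : List ℕ}, D.Encodes M is →
    neighbours D X < 2 ^ 128 ∧ ∀ x < 128, (neighbours D X).testBit x = true →
      ∃ i ∈ is, X.testBit (x ^^^ 2 ^ i) = true
  | .nil, [], _ => ⟨Nat.two_pow_pos _, fun x _ h => by simp [neighbours] at h⟩
  | .cons lo s t tl, i :: is, ⟨hf, _, htl⟩ => by
    obtain ⟨h1, h2⟩ := neighbours_spec (X := X) htl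
    refine ⟨Nat.or_lt_two_pow (flipMask_lt hf X) h1, fun x hx h => ?_⟩
    change (flipMask lo s X ||| neighbours tl X).testBit x = true at h
    rw [Nat.testBit_or, Bool.or_eq_true, testBit_flipMask hf X hx] at h
    rcases h with h | h
    · exact ⟨i, by simp, h⟩
    · obtain ⟨j, hj, h⟩ := h2 x hx h
      exact ⟨j, by simp [hj], h⟩

/-- Every vertex returned by `next` arises from a member `z` of `X` by going along a list `l` of
at least `r` directions such that the neighbours of `z` in these directions belong to `M`. -/
def StarSound (M r : ℕ) (next : Dirs → ℕ → ℕ) : Prop :=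
  ∀ (D : Dirs) (is : List ℕ) (X : ℕ), D.Encodes M is → is.Nodup → (∀ i ∈ is, i < 7) →
    X < 2 ^ 128 → next D X < 2 ^ 128 ∧ ∀ x < 128, (next D X).testBit x = true →
      ∃ l : List ℕ, l.Nodup ∧ l ⊆ is ∧ r ≤ l.length ∧ X.testBit (x ^^^ xorPow l) = true ∧
        ∀ i ∈ l, M.testBit (x ^^^ xorPow l ^^^ 2 ^ i) = true

theorem starSound_self (M : ℕ) : StarSound M 0 (fun _ y => y) :=
  fun _ _ _ _ _ _ hX => ⟨hX, fun x _ h => ⟨[], by simp, by simp, le_rfl, by simpa using h, by simp⟩⟩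

theorem StarSound.choose {M r : ℕ} {next : Dirs → ℕ → ℕ} (hn : StarSound M r next) :
    StarSound M (r + 1) (choose next) := by
  intro D
  induction D with
  | nil =>
    intro is X _ _ _ _
    exact ⟨Nat.two_pow_pos _, fun x _ h => by simp [CubeVisibility.choose] at h⟩
  | cons lo s t tl ih =>
    intro is X hD hnd his hX
    match is, hD with
    | i :: is, ⟨hf, ht, htl⟩ =>
      rw [List.nodup_cons] at hnd
      rw [List.forall_mem_cons] at his
      obtain ⟨h1, h2⟩ := ih is X htl hnd.2 his.2 hX
      have hy : X &&& t < 2 ^ 128 := Nat.and_lt_two_pow _ (ht ▸ flipMask_lt hf M)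
      obtain ⟨h3, h4⟩ := hn tl is (X &&& t) htl hnd.2 his.2 hy
      have heq : CubeVisibility.choose next (.cons lo s t tl) X =
          (if X &&& t = 0 then 0 else if next tl (X &&& t) = 0 then 0 else
            flipMask lo s (next tl (X &&& t))) ||| CubeVisibility.choose next tl X := by
        change forceNonempty (X &&& t) 0 (fun y => forceNonempty (next tl y) 0
          fun z => flipMask lo s z) ||| CubeVisibility.choose next tl X = _
        rw [forceNonempty_eq hy, forceNonempty_eq h3]
      rw [heq]
      constructor
      · refine Nat.or_lt_two_pow ?_ h1
        split_ifs
        · exact Nat.two_pow_pos _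
        · exact Nat.two_pow_pos _
        · exact flipMask_lt hf _
      · intro x hx h
        rw [Nat.testBit_or, Bool.or_eq_true] at h
        rcases h with h | h
        · have h : (flipMask lo s (next tl (X &&& t))).testBit x = true := by
            split_ifs at h
            · simp at h
            · simp at h
            · exact h
          rw [testBit_flipMask hf _ hx] at h
          obtain ⟨l, hl, hsub, hr, hlX, hlM⟩ := h4 _ (xor_lt his.1 hx) h
          have hz : x ^^^ xorPow (i :: l) = x ^^^ 2 ^ i ^^^ xorPow l := by
            rw [xorPow_cons, Nat.xor_assoc]
          have hzlt : x ^^^ 2 ^ i ^^^ xorPow l < 128 :=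
            Nat.xor_lt_two_pow (n := 7) (xor_lt his.1 hx)
              (xorPow_lt fun j hj => his.2 j (hsub hj))
          rw [Nat.testBit_and, Bool.and_eq_true, ht, testBit_flipMask hf _ hzlt] at hlX
          refine ⟨i :: l, List.nodup_cons.2 ⟨fun h => hnd.1 (hsub h), hl⟩,
            List.cons_subset_cons i hsub, by simpa using hr, by rw [hz]; exact hlX.1, ?_⟩
          rw [hz, List.forall_mem_cons]
          exact ⟨hlX.2, hlM⟩
        · obtain ⟨l, hl, hsub, hr, hlX, hlM⟩ := h2 x hx h
          exact ⟨l, hl, List.subset_cons_of_subset _ hsub, hr, hlX, hlM⟩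

theorem starSound_chooseAtMostOne (M : ℕ) : StarSound M 0 chooseAtMostOne := by
  intro D is X hD hnd his hX
  obtain ⟨h1, h2⟩ := (starSound_self M).choose D is X hD hnd his hX
  refine ⟨Nat.or_lt_two_pow hX h1, fun x hx h => ?_⟩
  change (X ||| choose (fun _ y => y) D X).testBit x = true at h
  rw [Nat.testBit_or, Bool.or_eq_true] at h
  rcases h with h | h
  · exact ⟨[], by simp, by simp, le_rfl, by simpa using h, by simp⟩
  · obtain ⟨l, hl, hsub, -, hlX, hlM⟩ := h2 x hx h
    exact ⟨l, hl, hsub, Nat.zero_le _, hlX, hlM⟩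

theorem withExcluded_eq {n : ℕ} {l : List (ℕ × ℕ)} (hl : DirData l (List.range n)) (hn : n ≤ 7)
    {m : ℕ → Bool} (hm : Admissible n m) {M : ℕ} (hM : M < 2 ^ 128) :
    ∃ f g, f < 2 ^ 128 ∧ g < 2 ^ 128 ∧ (∀ k, withExcluded l M k = k f g) ∧
      ((∀ x < 128, M.testBit x = true → m x = true) →
        (∀ x < 128, f.testBit x = true → m x = false) ∧
        ∀ x < 128, g.testBit x = true → m x = true → M.testBit x = true) := by
  obtain ⟨D, hD, hk⟩ := withDirs_eq M hl
  obtain ⟨on, tw, htw, hk', hO, hT⟩ :=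
    withCounts_eq hD List.nodup_range 0 0 (by decide) (by decide)
  have his : ∀ i ∈ List.range n, i < 7 := fun i hi => (List.mem_range.1 hi).trans_le hn
  obtain ⟨hs1, hs2⟩ := (starSound_chooseAtMostOne M).choose.choose.choose D _ fullMask hD
    List.nodup_range his (by decide)
  have hf : tw ||| starMask D < 2 ^ 128 := Nat.or_lt_two_pow htw hs1
  have hmt : M &&& on < 2 ^ 128 := by rw [Nat.and_comm]; exact Nat.and_lt_two_pow _ hM
  obtain ⟨hn1, hn2⟩ := neighbours_spec (X := M &&& on) hD
  have hg : tw ||| starMask D ||| neighbours D (M &&& on) < 2 ^ 128 := Nat.or_lt_two_pow hf hn1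
  refine ⟨_, _, hf, hg, fun k => ?_, fun hMm => ?_⟩
  · change withDirs M l (fun D => withCounts D 0 0 fun on tw =>
      forceMask (tw ||| starMask D) fun f => forceMask (M &&& on) fun mt =>
        forceMask (f ||| neighbours D mt) fun g => k f g) = _
    rw [hk, hk', forceMask_eq hf, forceMask_eq hmt, forceMask_eq hg]
  · have hf' : ∀ x < 128, (tw ||| starMask D).testBit x = true → m x = false := by
      intro x hx h
      rw [Nat.testBit_or, Bool.or_eq_true] at h
      by_contra hxm
      rw [Bool.not_eq_false] at hxm
      rcases h with h | h
      · rcases hT x hx h with h | h | ⟨i, hi, j, hj, hij, hxi, hxj⟩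
        · simp at h
        · simp at h
        · obtain ⟨k, hk, h⟩ := hm (x ^^^ 2 ^ i ^^^ 2 ^ j) [i, j] (by simpa using hij)
            (by simpa using ⟨List.mem_range.1 hi, List.mem_range.1 hj⟩) le_rfl (by
              rw [← hxm]; congr 1
              simp only [xorPow_cons, xorPow_nil, Nat.xor_zero]
              rw [Nat.xor_assoc, Nat.xor_assoc, ← Nat.xor_assoc (2 ^ j), Nat.xor_comm (2 ^ j),
                Nat.xor_assoc (2 ^ i), Nat.xor_self, Nat.xor_zero, Nat.xor_self, Nat.xor_zero])
          have hi' := hMm _ (xor_lt (his i hi) hx) hxi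
          have hj' := hMm _ (xor_lt (his j hj) hx) hxj
          simp only [List.mem_cons, List.not_mem_nil, or_false] at hk
          rcases hk with rfl | rfl
          · rw [Nat.xor_assoc, Nat.xor_comm (2 ^ j), ← Nat.xor_assoc, Nat.xor_assoc x,
              Nat.xor_self, Nat.xor_zero, hj'] at h
            exact absurd h (by simp)
          · rw [Nat.xor_assoc, Nat.xor_self, Nat.xor_zero, hi'] at h
            exact absurd h (by simp)
      · obtain ⟨d, hd, hsub, hr, -, hdM⟩ := hs2 x hx h
        have hdn : ∀ i ∈ d, i < n := fun i hi => List.mem_range.1 (hsub hi)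
        obtain ⟨i, hi, h⟩ := hm (x ^^^ xorPow d) d hd hdn (by omega)
          (by rw [Nat.xor_assoc, Nat.xor_self, Nat.xor_zero]; exact hxm)
        have hzlt : x ^^^ xorPow d < 128 :=
          Nat.xor_lt_two_pow (n := 7) hx (xorPow_lt fun i hi => (hdn i hi).trans_le hn)
        rw [hMm _ (xor_lt ((hdn i hi).trans_le hn) hzlt) (hdM i hi)] at h
        exact absurd h (by simp)
    refine ⟨hf', fun x hx h hxm => ?_⟩
    rw [Nat.testBit_or, Bool.or_eq_true] at h
    rcases h with h | h
    · rw [hf' x hx h] at hxm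
      exact absurd hxm (by simp)
    · -- `x` is adjacent to a member `v` of `M` that has a neighbour in `M`.
      obtain ⟨i, hi, h⟩ := hn2 x hx h
      rw [Nat.testBit_and, Bool.and_eq_true] at h
      have hin := List.mem_range.1 hi
      rcases hO _ (xor_lt (his i hi) hx) h.2 with h0 | ⟨j, hj, hjM⟩
      · simp at h0
      · by_cases hij : i = j
        · subst hij
          rwa [Nat.xor_assoc, Nat.xor_self, Nat.xor_zero] at hjM
        · obtain ⟨k, hk, h'⟩ := hm (x ^^^ 2 ^ j) [i, j] (by simpa using hij)
            (by simpa using ⟨hin, List.mem_range.1 hj⟩) le_rfl (by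
              have hv := hMm _ (xor_lt (his i hi) hx) h.1
              rw [← hv]; congr 1
              simp only [xorPow_cons, xorPow_nil, Nat.xor_zero]
              rw [Nat.xor_assoc, Nat.xor_comm (2 ^ i), ← Nat.xor_assoc (2 ^ j), Nat.xor_self,
                Nat.zero_xor])
          have hj' := hMm _ (xor_lt (his j hj) (xor_lt (his i hi) hx)) hjM
          simp only [List.mem_cons, List.not_mem_nil, or_false] at hk
          rcases hk with rfl | rfl
          · rw [Nat.xor_assoc, Nat.xor_comm (2 ^ j), ← Nat.xor_assoc, hj'] at h'
            exact absurd h' (by simp)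
          · rw [Nat.xor_assoc, Nat.xor_self, Nat.xor_zero, hxm] at h'
            exact absurd h' (by simp)

theorem extend_spec {n N nb cap need fuel : ℕ} {l : List (ℕ × ℕ)}
    (hl : DirData l (List.range n)) (hn4 : 4 ≤ n) (hn : n ≤ 7) (hN : N ≤ 128) (hnb : 16 * nb ≤ N)
    (hcap : ∀ m, Admissible 4 m → vertexCount m 16 ≤ cap)
    {m : ℕ → Bool} (hm : Admissible n m) (hneed : need ≤ vertexCount m (16 * nb))
    {k : ℕ → Bool} :
    ∀ {In c : ℕ}, In < 2 ^ 128 → c < 2 ^ 128 → (∀ x < 128, In.testBit x = true → m x = true) →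
      (∀ x < N, m x = true → In.testBit x = true ∨ c.testBit x = true) →
      extend l nb cap need k fuel In c = true →
      ∃ L < 2 ^ 128, k L = true ∧ ∀ x < N, L.testBit x = m x := by
  induction fuel with
  | zero => intro In c _ _ _ _ h; exact absurd h Bool.false_ne_true
  | succ fuel ih =>
    intro In c hIn hc hInm hcov h
    change branch (Nat.ble need (blockBound cap nb (In ||| c)))
      (forceNonempty c (k In) fun c =>
        forceMask (c &&& (c - 1)) fun c1 => forceMask (In ||| (c ^^^ c1)) fun In1 =>
          branch (withExcluded l In1 fun f g => branch (Nat.beq (In1 &&& f) 0)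
              (forceMask (c1 ^^^ (c1 &&& g)) fun c2 => extend l nb cap need k fuel In1 c2) true)
           (extend l nb cap need k fuel In c1) false) true = true at h
    have hbound : need ≤ blockBound cap nb (In ||| c) := by
      refine hneed.trans (vertexCount_le_blockBound hcap nb (hm.mono hn4)
        (Nat.or_lt_two_pow hIn hc) fun x hx hxm => ?_)
      rw [Nat.testBit_or, Bool.or_eq_true]
      exact hcov x (hx.trans_le hnb) hxm
    rw [branch_eq, if_pos (Nat.ble_eq_true_of_le hbound), forceNonempty_eq hc] at h
    by_cases hc0 : c = 0
    · rw [if_pos hc0] at h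
      refine ⟨In, hIn, h, fun x hx => ?_⟩
      have h1 := hInm x (hx.trans_le hN)
      have h2 := hcov x hx
      rw [hc0, Nat.zero_testBit] at h2
      revert h1 h2
      cases In.testBit x <;> cases m x <;> simp
    rw [if_neg hc0] at h
    obtain ⟨v, hv, hc1⟩ := exists_clear_lowest hc0
    have hv128 : v < 128 := by
      by_contra hlt
      rw [testBit_eq_false_of_lt hc (not_lt.1 hlt)] at hv
      exact absurd hv (by simp)
    set c1 := c &&& (c - 1) with hc1def
    have hc1lt : c1 < 2 ^ 128 := by rw [hc1def, Nat.and_comm]; exact Nat.and_lt_two_pow _ hc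
    have hIn1lt : In ||| (c ^^^ c1) < 2 ^ 128 :=
      Nat.or_lt_two_pow hIn (Nat.xor_lt_two_pow hc hc1lt)
    have hbit : ∀ x, (In ||| (c ^^^ c1)).testBit x = (In.testBit x || decide (x = v)) := by
      intro x
      rw [Nat.testBit_or, Nat.testBit_xor, hc1]
      by_cases hxv : x = v
      · subst hxv; simp [hv]
      · simp [hxv]
    rw [forceMask_eq hc1lt, forceMask_eq hIn1lt, branch_eq] at h
    have hboth : (withExcluded l (In ||| (c ^^^ c1)) fun f g =>
        branch (Nat.beq ((In ||| (c ^^^ c1)) &&& f) 0) (forceMask (c1 ^^^ (c1 &&& g)) fun c2 =>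
          extend l nb cap need k fuel (In ||| (c ^^^ c1)) c2) true) = true ∧
        extend l nb cap need k fuel In c1 = true := by
      split_ifs at h with h'
      exact ⟨h', h⟩
    obtain ⟨hwith, hwithout⟩ := hboth
    by_cases hmv : m v = true
    · -- The lowest candidate belongs to the set.
      have hIn1m : ∀ x < 128, (In ||| (c ^^^ c1)).testBit x = true → m x = true := by
        intro x hx hxb
        rw [hbit, Bool.or_eq_true, decide_eq_true_eq] at hxb
        rcases hxb with hxb | rfl
        · exact hInm x hx hxb
        · exact hmv
      obtain ⟨f, g, hf, hg, hk, hfg⟩ := withExcluded_eq hl hn hm hIn1lt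
      obtain ⟨hfm, hgm⟩ := hfg hIn1m
      have hzero : (In ||| (c ^^^ c1)) &&& f = 0 := by
        refine Nat.eq_of_testBit_eq fun x => ?_
        rw [Nat.zero_testBit, Nat.testBit_and]
        by_cases hx : x < 128
        · have h1 := hIn1m x hx
          have h2 := hfm x hx
          revert h1 h2
          cases (In ||| (c ^^^ c1)).testBit x <;> cases f.testBit x <;> cases m x <;> simp
        · rw [testBit_eq_false_of_lt hf (not_lt.1 hx), Bool.and_false]
      have hc2lt : c1 ^^^ (c1 &&& g) < 2 ^ 128 :=
        Nat.xor_lt_two_pow hc1lt (Nat.and_lt_two_pow _ hg)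
      rw [hk, branch_eq, hzero, if_pos (by rfl), forceMask_eq hc2lt] at hwith
      refine ih hIn1lt hc2lt hIn1m (fun x hx hxm => ?_) hwith
      have h1 := hcov x hx hxm
      have h2 := hgm x (hx.trans_le hN)
      rw [hxm] at h2
      rw [hbit] at h2 ⊢
      rw [Nat.testBit_xor, Nat.testBit_and c1 g, hc1]
      revert h1 h2
      cases In.testBit x <;> cases c.testBit x <;> cases g.testBit x <;>
        by_cases hxv : x = v <;> simp [hxv]
    · refine ih hIn hc1lt hInm (fun x hx hxm => ?_) hwithout
      refine (hcov x hx hxm).imp_right fun hcx => ?_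
      rw [hc1, hcx]
      have : x ≠ v := fun e => hmv (e ▸ hxm)
      simp [this]

theorem search_spec {n N nb cap need : ℕ} {l : List (ℕ × ℕ)}
    (hl : DirData l (List.range n)) (hn4 : 4 ≤ n) (hn : n ≤ 7) (hN : N ≤ 128) (hnb : 16 * nb ≤ N)
    (hcap : ∀ m, Admissible 4 m → vertexCount m 16 ≤ cap)
    {m : ℕ → Bool} (hm : Admissible n m) (hneed : need ≤ vertexCount m (16 * nb))
    {k : ℕ → Bool} {A C : ℕ} (hA : A < 2 ^ 128) (hC : C < 2 ^ 128)
    (hAm : ∀ x < 128, A.testBit x = true → m x = true)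
    (hcov : ∀ x < N, m x = true → A.testBit x = true ∨ C.testBit x = true)
    (h : search l nb cap need k A C = true) :
    ∃ L < 2 ^ 128, k L = true ∧ ∀ x < N, L.testBit x = m x := by
  obtain ⟨f, g, -, hg, hk, hfg⟩ := withExcluded_eq hl hn hm hA
  have hc : C ^^^ (C &&& g) < 2 ^ 128 := Nat.xor_lt_two_pow hC (Nat.and_lt_two_pow _ hg)
  change withExcluded l A (fun _ g => forceMask (C ^^^ (C &&& g))
    fun c => extend l nb cap need k 70 A c) = true at h
  rw [hk, forceMask_eq hc] at h
  refine extend_spec hl hn4 hn hN hnb hcap hm hneed hA hc hAm (fun x hx hxm => ?_) h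
  have h1 := hcov x hx hxm
  have h2 := (hfg hAm).2 x (hx.trans_le hN)
  rw [hxm] at h2
  rw [Nat.testBit_xor, Nat.testBit_and]
  revert h1 h2
  cases A.testBit x <;> cases C.testBit x <;> cases g.testBit x <;> simp

/-! ### Automorphisms acting on bit masks -/

/-- The mask of the vertices below `128` whose coordinate `i` is one and whose coordinate `j`
vanishes, where `i < j`. -/
def swapLow (i j : ℕ) : ℕ :=
  Nat.land (Nat.shiftLeft (lowMask i) (Nat.pow 2 i)) (lowMask j)

/-- The image of the mask `M` under the exchange of the coordinates `i < j`, where `a = swapLow i j`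
and `s = 2 ^ j - 2 ^ i`: the vertices that move are those of `a` and those of `a` shifted
by `s`. -/
noncomputable def swapMask (a s M : ℕ) : ℕ :=
  Nat.lor (Nat.land M (Nat.xor fullMask (Nat.lor a (Nat.shiftLeft a s))))
    (Nat.lor (Nat.shiftLeft (Nat.land M a) s) (Nat.land (Nat.shiftRight M s) a))

/-- The image of the mask `M` under the automorphism `move g`, for `g.1 ≤ g.2`. -/
noncomputable def moveMask (g : ℕ × ℕ) (M : ℕ) : ℕ :=
  branch (Nat.beq g.1 g.2) (flipMask (lowMask g.1) (Nat.pow 2 g.1) M)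
    (swapMask (swapLow g.1 g.2) (Nat.sub (Nat.pow 2 g.2) (Nat.pow 2 g.1)) M)

theorem swapLow_spec : ∀ i < 7, ∀ j < 7, i < j → ∀ x < 128,
    ((swapLow i j).testBit x = true →
      (decide (2 ^ j - 2 ^ i ≤ x) && (swapLow i j).testBit (x - (2 ^ j - 2 ^ i))) = false) ∧
    move (i, j) x = if (swapLow i j).testBit x = true then 2 ^ j - 2 ^ i + x
      else if (decide (2 ^ j - 2 ^ i ≤ x) && (swapLow i j).testBit (x - (2 ^ j - 2 ^ i))) = true
        then x - (2 ^ j - 2 ^ i) else x := by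
  decide +kernel

theorem swapLow_lt : ∀ i < 7, ∀ j < 7, i < j →
    swapLow i j < 2 ^ 128 ∧ swapLow i j <<< (2 ^ j - 2 ^ i) < 2 ^ 128 := by
  decide +kernel

theorem testBit_fullMask : ∀ x < 128, fullMask.testBit x = true := by
  decide +kernel

theorem testBit_swapMask {i j : ℕ} (hij : i < j) (hj : j < 7) (M : ℕ) {x : ℕ} (hx : x < 128) :
    (swapMask (swapLow i j) (2 ^ j - 2 ^ i) M).testBit x = M.testBit (move (i, j) x) := by
  obtain ⟨h1, h2⟩ := swapLow_spec i (hij.trans hj) j hj hij x hx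
  have hfull := testBit_fullMask x hx
  rw [h2]
  generalize swapLow i j = a at h1
  generalize 2 ^ j - 2 ^ i = s at h1
  change (M &&& (fullMask ^^^ (a ||| a <<< s)) |||
    ((M &&& a) <<< s ||| M >>> s &&& a)).testBit x = _
  simp only [Nat.testBit_or, Nat.testBit_and, Nat.testBit_xor, Nat.testBit_shiftLeft,
    Nat.testBit_shiftRight, hfull, ge_iff_le]
  cases ha : a.testBit x with
  | true =>
    rw [if_pos rfl]
    have h3 := h1 ha
    cases hs : decide (s ≤ x) <;> simp_all
  | false =>
    rw [if_neg (by simp)]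
    cases hs : decide (s ≤ x) <;> cases hb : a.testBit (x - s) <;> simp

theorem swapMask_lt {a s : ℕ} (ha : a < 2 ^ 128) (has : a <<< s < 2 ^ 128) (M : ℕ) :
    swapMask a s M < 2 ^ 128 := by
  refine Nat.or_lt_two_pow (Nat.and_lt_two_pow _ (Nat.xor_lt_two_pow (by decide)
    (Nat.or_lt_two_pow ha has))) (Nat.or_lt_two_pow ?_ (Nat.and_lt_two_pow _ ha))
  refine lt_of_le_of_lt ?_ has
  change (M &&& a) <<< s ≤ a <<< s
  rw [Nat.shiftLeft_eq, Nat.shiftLeft_eq]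
  exact Nat.mul_le_mul_right _ Nat.and_le_right

/-- All moves in the word act on the first `n` coordinates and are written with the smaller
coordinate first, as `moveMask` expects. -/
def OrderedBelow (n : ℕ) (w : List (ℕ × ℕ)) : Prop := ∀ g ∈ w, g.1 ≤ g.2 ∧ g.2 < n

instance (n : ℕ) (w : List (ℕ × ℕ)) : Decidable (OrderedBelow n w) :=
  inferInstanceAs (Decidable (∀ g ∈ w, g.1 ≤ g.2 ∧ g.2 < n))

theorem testBit_moveMask {g : ℕ × ℕ} (h12 : g.1 ≤ g.2) (h2 : g.2 < 7) (M : ℕ) {x : ℕ}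
    (hx : x < 128) : (moveMask g M).testBit x = M.testBit (move g x) := by
  obtain ⟨i, j⟩ := g
  rw [moveMask, branch_eq]
  by_cases hij : i = j
  · subst hij
    rw [if_pos (Nat.beq_refl i)]
    exact (testBit_flipMask ⟨h2, rfl, rfl⟩ M hx).trans (by simp [move])
  · rw [if_neg fun h => hij (Nat.eq_of_beq_eq_true h)]
    exact testBit_swapMask (lt_of_le_of_ne h12 hij) h2 M hx

theorem moveMask_lt {g : ℕ × ℕ} (h12 : g.1 ≤ g.2) (h2 : g.2 < 7) (M : ℕ) :
    moveMask g M < 2 ^ 128 := by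
  obtain ⟨i, j⟩ := g
  rw [moveMask, branch_eq]
  by_cases hij : i = j
  · subst hij
    rw [if_pos (Nat.beq_refl i)]
    exact flipMask_lt ⟨h2, rfl, rfl⟩ M
  · rw [if_neg fun h => hij (Nat.eq_of_beq_eq_true h)]
    obtain ⟨ha, has⟩ := swapLow_lt i (h12.trans_lt h2) j h2 (lt_of_le_of_ne h12 hij)
    exact swapMask_lt ha has M

/-! ### Recognition up to automorphism -/

/-- Hands the image of the mask `N` under the word `w` to `k`. -/
noncomputable def moveMasks (w : List (ℕ × ℕ)) (k : ℕ → Bool) : ℕ → Bool :=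
  List.rec k (fun g _ ih N => forceMask (moveMask g N) ih) w

/-- Whether the image of `N` under one of the words satisfies `k`. -/
noncomputable def anyWord (ws : List (List (ℕ × ℕ))) (k : ℕ → Bool) (N : ℕ) : Bool :=
  List.rec false (fun w _ ih => branch (moveMasks w k N) true ih) ws

/-- Whether some image of `N` satisfies `k`, where one word is taken from each list. -/
noncomputable def anyImage (opts : List (List (List (ℕ × ℕ)))) (k : ℕ → Bool) : ℕ → Bool :=
  List.rec k (fun ws _ ih N => anyWord ws ih N) opts

/-- Membership of `N` in a list. -/
noncomputable def mem (R : List ℕ) (N : ℕ) : Bool :=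
  List.rec false (fun A _ ih => branch (Nat.beq A N) true ih) R

/-- Looks up a word for `N` in a table and applies it to `N`. -/
noncomputable def viaTable (T : List (ℕ × List (ℕ × ℕ))) (k : ℕ → Bool) (N : ℕ) : Bool :=
  List.rec false (fun e _ ih => branch (Nat.beq e.1 N) (moveMasks e.2 k N) ih) T

/-- The set given by `m` is equivalent under an automorphism of the cube of dimension `n` to the
set of one of the masks in `R`. -/
def EquivalentTo (n : ℕ) (R : List ℕ) (m : ℕ → Bool) : Prop :=
  ∃ w, WordBelow n w ∧ ∃ A ∈ R, ∀ x < 2 ^ n, A.testBit x = m (moves w x)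

theorem EquivalentTo.of_moves {n : ℕ} {R : List ℕ} {m : ℕ → Bool} {w : List (ℕ × ℕ)}
    (hw : WordBelow n w) (h : EquivalentTo n R fun x => m (moves w x)) : EquivalentTo n R m := by
  obtain ⟨w', hw', A, hA, h⟩ := h
  refine ⟨w ++ w', fun g hg => (List.mem_append.1 hg).elim (hw g) (hw' g), A, hA, fun x hx => ?_⟩
  simp only [h x hx, moves, List.foldr_append]

theorem EquivalentTo.congr {n : ℕ} {R : List ℕ} {m m' : ℕ → Bool} (h : EquivalentTo n R m)
    (hm : ∀ x < 2 ^ n, m x = m' x) : EquivalentTo n R m' := by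
  obtain ⟨w, hw, A, hA, h⟩ := h
  exact ⟨w, hw, A, hA, fun x hx => (h x hx).trans (hm _ (moves_lt hw hx))⟩

/-- `k` accepts only masks equivalent to a member of `R`. -/
def Recognizes (n : ℕ) (R : List ℕ) (k : ℕ → Bool) : Prop :=
  ∀ N < 2 ^ 128, k N = true → EquivalentTo n R N.testBit

theorem Recognizes.const_false (n : ℕ) (R : List ℕ) : Recognizes n R fun _ => false :=
  fun _ _ h => absurd h (by simp)

theorem Recognizes.mem (n : ℕ) (R : List ℕ) : Recognizes n R (mem R) := by
  intro N _ h
  suffices N ∈ R from ⟨[], fun _ h => absurd h (by simp), N, this, fun _ _ => rfl⟩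
  induction R with
  | nil => exact absurd h (by simp [CubeVisibility.mem])
  | cons A R ih =>
    change branch (Nat.beq A N) true (CubeVisibility.mem R N) = true at h
    rw [branch_eq] at h
    split_ifs at h with h1
    · exact List.mem_cons.2 (Or.inl (Nat.eq_of_beq_eq_true h1).symm)
    · exact List.mem_cons_of_mem _ (ih h)

theorem Recognizes.moveMasks {n : ℕ} (hn : n ≤ 7) {R : List ℕ} {k : ℕ → Bool}
    (hk : Recognizes n R k) {w : List (ℕ × ℕ)} (hw : OrderedBelow n w) :
    Recognizes n R (moveMasks w k) := by
  induction w with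
  | nil => exact hk
  | cons g w ih =>
    intro N _ h
    rw [OrderedBelow, List.forall_mem_cons] at hw
    change forceMask (moveMask g N) (CubeVisibility.moveMasks w k) = true at h
    have hg := hw.1.2.trans_le hn
    have hlt := moveMask_lt hw.1.1 hg N
    rw [forceMask_eq hlt] at h
    refine EquivalentTo.of_moves (w := [g])
      (by simpa [WordBelow] using ⟨hw.1.1.trans_lt hw.1.2, hw.1.2⟩) ?_
    exact (ih hw.2 _ hlt h).congr fun x hx =>
      testBit_moveMask hw.1.1 hg N (hx.trans_le (Nat.pow_le_pow_right two_pos hn))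

theorem Recognizes.anyWord {n : ℕ} (hn : n ≤ 7) {R : List ℕ} {k : ℕ → Bool}
    (hk : Recognizes n R k) {ws : List (List (ℕ × ℕ))} (hws : ∀ w ∈ ws, OrderedBelow n w) :
    Recognizes n R (anyWord ws k) := by
  induction ws with
  | nil => exact Recognizes.const_false n R
  | cons w ws ih =>
    intro N hN h
    rw [List.forall_mem_cons] at hws
    change branch (CubeVisibility.moveMasks w k N) true (CubeVisibility.anyWord ws k N) = true at h
    rw [branch_eq] at h
    split_ifs at h with h1
    · exact hk.moveMasks hn hws.1 N hN h1
    · exact ih hws.2 N hN h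

theorem Recognizes.anyImage {n : ℕ} (hn : n ≤ 7) {R : List ℕ} {k : ℕ → Bool}
    (hk : Recognizes n R k) {opts : List (List (List (ℕ × ℕ)))}
    (hopts : ∀ ws ∈ opts, ∀ w ∈ ws, OrderedBelow n w) : Recognizes n R (anyImage opts k) := by
  induction opts with
  | nil => exact hk
  | cons ws opts ih =>
    rw [List.forall_mem_cons] at hopts
    exact (ih hopts.2).anyWord hn hopts.1

theorem Recognizes.viaTable {n : ℕ} (hn : n ≤ 7) {R : List ℕ} {k : ℕ → Bool}
    (hk : Recognizes n R k) {T : List (ℕ × List (ℕ × ℕ))} (hT : ∀ e ∈ T, OrderedBelow n e.2) :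
    Recognizes n R (viaTable T k) := by
  induction T with
  | nil => exact Recognizes.const_false n R
  | cons e T ih =>
    intro N hN h
    rw [List.forall_mem_cons] at hT
    change branch (Nat.beq e.1 N) (CubeVisibility.moveMasks e.2 k N)
      (CubeVisibility.viaTable T k N) = true at h
    rw [branch_eq] at h
    split_ifs at h
    · exact hk.moveMasks hn hT.1 N hN h
    · exact ih hT.2 N hN h

/-! ### Passage to the next dimension -/

/-- The constants for the directions of the cube of dimension seven. -/
def directions : List (ℕ × ℕ) :=
  [(0x55555555555555555555555555555555, 1), (0x33333333333333333333333333333333, 2),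
    (0x0f0f0f0f0f0f0f0f0f0f0f0f0f0f0f0f, 4), (0x00ff00ff00ff00ff00ff00ff00ff00ff, 8),
    (0x0000ffff0000ffff0000ffff0000ffff, 16), (0x00000000ffffffff00000000ffffffff, 32),
    (0x0000000000000000ffffffffffffffff, 64)]

theorem dirData_directions : DirData directions (List.range 7) := by
  unfold directions DirData FlipData
  decide +kernel

theorem dirData_take {n : ℕ} (hn : n ≤ 7) : DirData (directions.take n) (List.range n) := by
  have h := List.forall₂_take n dirData_directions
  rwa [List.take_range, Nat.min_eq_left hn] at h

theorem vertexCount_le_length (m : ℕ → Bool) (N : ℕ) : vertexCount m N ≤ N := Nat.count_le _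

/-- The search through the whole cube of dimension four. -/
theorem exists_mask_of_search₄ {m : ℕ → Bool} (hm : Admissible 4 m) {need : ℕ}
    (hneed : need ≤ vertexCount m 16) {p : ℕ → Bool}
    (h : search (directions.take 4) 1 16 need p 0 65535 = true) :
    ∃ L < 2 ^ 128, p L = true ∧ ∀ x < 16, L.testBit x = m x := by
  -- The trivial bound `16` for the single block is used.
  refine search_spec (N := 16) (dirData_take (by decide)) le_rfl (by decide) (by decide) le_rfl
    (fun m _ => vertexCount_le_length m 16) hm hneed (by decide) (by decide) ?_ ?_ h
  · intro x _ hx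
    simp at hx
  · have hall : ∀ x < 16, Nat.testBit 65535 x = true := by decide
    exact fun x hx _ => Or.inr (hall x hx)

theorem vertexCount_le_six {m : ℕ → Bool} (hm : Admissible 4 m) : vertexCount m 16 ≤ 6 := by
  by_contra hlt
  have h : search (directions.take 4) 1 16 7 (fun _ => false) 0 65535 = true := by decide +kernel
  obtain ⟨L, -, hL, -⟩ := exists_mask_of_search₄ hm (by omega) h
  simp at hL

/-- Searches for the admissible sets with at least `target` members in the cube of dimension
`k + 1` whose part with vanishing last coordinate is given by the mask `A`. The candidates are
kept in the lower half, so `A` is first moved to the upper one. -/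
noncomputable def searchAbove (k target : ℕ) (p : ℕ → Bool) (A : ℕ) : Bool :=
  force (Nat.sub target (vertexCount A.testBit (2 ^ k))) fun need =>
    search (directions.take (k + 1)) (Nat.div (Nat.pow 2 k) 16) 6 need p
      (Nat.shiftLeft A (Nat.pow 2 k)) (Nat.sub (Nat.pow 2 (Nat.pow 2 k)) 1)

/-- An admissible set whose lower half is `A` is found, after an exchange of the two halves, by
`searchAbove`. -/
theorem EquivalentTo.of_searchAbove {k : ℕ} (hk4 : 4 ≤ k) (hk : k < 7)
    {m : ℕ → Bool} (hm : Admissible (k + 1) m) {A target : ℕ} (hA : A < 2 ^ 2 ^ k)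
    (hAm : ∀ x < 2 ^ k, A.testBit x = m x) (ht : target ≤ vertexCount m (2 ^ (k + 1)))
    {R : List ℕ} {p : ℕ → Bool} (hp : Recognizes (k + 1) R p)
    (h : searchAbove k target p A = true) : EquivalentTo (k + 1) R m := by
  have hk64 : 2 ^ k ≤ 64 := Nat.pow_le_pow_right (n := 2) two_pos (show k ≤ 6 by omega)
  have hpow : 2 ^ (k + 1) = 2 ^ k + 2 ^ k := by rw [pow_succ, mul_two]
  have hdiv : 16 * (2 ^ k / 16) = 2 ^ k :=
    Nat.mul_div_cancel' (Nat.pow_dvd_pow 2 hk4 : 2 ^ 4 ∣ 2 ^ k)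
  have hg : WordBelow (k + 1) [(k, k)] := by simp [WordBelow]
  have hmv : ∀ x, moves [(k, k)] x = x ^^^ 2 ^ k := fun x => by simp [moves, move]
  have hlow : ∀ x < 2 ^ k, x ^^^ 2 ^ k = 2 ^ k + x := fun x hx => by
    rw [xor_two_pow_eq k hk x (by omega), Nat.testBit_lt_two_pow hx, if_neg (by simp), add_comm]
  have hhigh : ∀ x < 2 ^ k, (2 ^ k + x) ^^^ 2 ^ k = x := fun x hx => by
    rw [← hlow x hx, Nat.xor_xor_cancel_right]
  refine EquivalentTo.of_moves hg ?_
  have hsum : vertexCount (fun x => m (moves [(k, k)] x)) (2 ^ k) + vertexCount A.testBit (2 ^ k) =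
      vertexCount m (2 ^ (k + 1)) := by
    rw [← vertexCount_comp_moves m hg, hpow, vertexCount_add]
    congr 1
    exact vertexCount_congr fun x hx => by rw [hmv, hhigh x hx, hAm x hx]
  have hshift : ∀ x, (A <<< 2 ^ k).testBit x = (decide (2 ^ k ≤ x) && A.testBit (x - 2 ^ k)) :=
    fun x => by rw [Nat.testBit_shiftLeft]
  rw [searchAbove, force_eq] at h
  suffices ∃ L < 2 ^ 128, p L = true ∧ ∀ x < 2 ^ (k + 1), L.testBit x = m (moves [(k, k)] x) by
    obtain ⟨L, hL, hpL, hLm⟩ := this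
    exact (hp L hL hpL).congr hLm
  refine search_spec (N := 2 ^ (k + 1)) (dirData_take hk) (by omega) hk
    (by omega) (by
      change 16 * (2 ^ k / 16) ≤ _
      omega) (fun m => vertexCount_le_six) (hm.comp_moves hg) (by
      change target - _ ≤ vertexCount _ (16 * (2 ^ k / 16))
      rw [hdiv]
      omega) ?_ ?_ ?_ ?_ h
  · change A <<< 2 ^ k < _
    rw [Nat.shiftLeft_eq]
    calc A * 2 ^ 2 ^ k < 2 ^ 2 ^ k * 2 ^ 2 ^ k := Nat.mul_lt_mul_of_pos_right hA (by positivity)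
      _ ≤ 2 ^ 128 := by rw [← pow_add]; exact Nat.pow_le_pow_right two_pos (by omega)
  · refine lt_of_le_of_lt (Nat.sub_le _ _) ?_
    exact Nat.pow_lt_pow_right one_lt_two (show 2 ^ k < 128 by omega)
  · intro x _ hx
    have hx' := (hshift x).symm.trans hx
    rw [Bool.and_eq_true, decide_eq_true_eq] at hx'
    have hlt : x - 2 ^ k < 2 ^ k := by
      by_contra hge
      rw [Nat.testBit_lt_two_pow (hA.trans_le (Nat.pow_le_pow_right two_pos (not_lt.1 hge)))] at hx'
      exact absurd hx'.2 (by simp)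
    rw [hAm _ hlt] at hx'
    have h2 := hhigh _ hlt
    rw [Nat.add_sub_cancel' hx'.1] at h2
    rw [hmv, h2, hx'.2]
  · intro x hx hmx
    by_cases hle : 2 ^ k ≤ x
    · left
      refine (hshift x).trans ?_
      have hlt : x - 2 ^ k < 2 ^ k := by omega
      have h2 := hhigh _ hlt
      rw [Nat.add_sub_cancel' hle] at h2
      rw [hmv, h2] at hmx
      rw [hAm _ hlt, hmx, decide_eq_true hle]
      rfl
    · right
      change (2 ^ 2 ^ k - 1).testBit x = true
      rw [Nat.testBit_two_pow_sub_one, decide_eq_true (not_le.1 hle)]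

/-- After a suitable change of the coordinate `k`, at least half of the members lie in the lower
half of the cube. -/
theorem exists_moves_lower_half (m : ℕ → Bool) {k : ℕ} (hk : k < 7) :
    ∃ w, WordBelow (k + 1) w ∧
      vertexCount m (2 ^ (k + 1)) ≤ 2 * vertexCount (fun x => m (moves w x)) (2 ^ k) := by
  have hk64 : 2 ^ k ≤ 64 := Nat.pow_le_pow_right (n := 2) two_pos (show k ≤ 6 by omega)
  have hcount : vertexCount m (2 ^ (k + 1)) =
      vertexCount m (2 ^ k) + vertexCount (fun x => m (moves [(k, k)] x)) (2 ^ k) := by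
    rw [pow_succ, mul_two, vertexCount_add]
    congr 1
    refine vertexCount_congr fun x hx => ?_
    have h1 : moves [(k, k)] x = 2 ^ k + x := by
      simp only [moves, List.foldr_cons, List.foldr_nil, move, if_true]
      rw [xor_two_pow_eq k hk x (by omega), Nat.testBit_lt_two_pow hx, if_neg (by simp), add_comm]
    rw [h1]
  rcases le_total (vertexCount m (2 ^ k))
    (vertexCount (fun x => m (moves [(k, k)] x)) (2 ^ k)) with h | h
  · exact ⟨[(k, k)], by simp [WordBelow], by omega⟩
  · refine ⟨[], fun g hg => absurd hg (by simp), ?_⟩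
    change _ ≤ 2 * vertexCount m (2 ^ k)
    omega

/-- If the large admissible sets in dimension `k` are classified by `R`, then it is enough to search
above the members of `R` for those in dimension `k + 1` with almost twice the size. -/
theorem EquivalentTo.succ {k : ℕ} (hk4 : 4 ≤ k) (hk : k < 7) {half target : ℕ}
    (ht : 2 * half ≤ target + 1) {R R' : List ℕ}
    (hR : ∀ m, Admissible k m → half ≤ vertexCount m (2 ^ k) → EquivalentTo k R m)
    (hR' : ∀ A ∈ R, A < 2 ^ 2 ^ k ∧
      ∃ p, Recognizes (k + 1) R' p ∧ searchAbove k target p A = true)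
    {m : ℕ → Bool} (hm : Admissible (k + 1) m) (hcount : target ≤ vertexCount m (2 ^ (k + 1))) :
    EquivalentTo (k + 1) R' m := by
  obtain ⟨w, hw, hhalf⟩ := exists_moves_lower_half m hk
  rw [← vertexCount_comp_moves m hw] at hcount hhalf
  have hm1 := hm.comp_moves hw
  obtain ⟨v, hv, A, hA, hAm⟩ := hR _ (hm1.mono k.le_succ) (by omega)
  have hv' : WordBelow (k + 1) v := hv.mono k.le_succ
  obtain ⟨hlt, p, hp, hs⟩ := hR' A hA
  rw [← vertexCount_comp_moves _ hv'] at hcount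
  exact ((EquivalentTo.of_searchAbove hk4 hk (hm1.comp_moves hv') hlt hAm hcount hp
    hs).of_moves hv').of_moves hw

/-! ### Large admissible sets in dimensions four, five and six -/

/-- For each coordinate of the cube of dimension four the option to change it, and then the
exchanges from which every permutation of the coordinates can be composed. -/
def symmetries₄ : List (List (List (ℕ × ℕ))) :=
  [[[], [(0, 0)]], [[], [(1, 1)]], [[], [(2, 2)]], [[], [(3, 3)]],
    [[], [(0, 3)], [(1, 3)], [(2, 3)]], [[], [(0, 2)], [(1, 2)]], [[], [(0, 1)]]]

/-- The analogue of `symmetries₄` in dimension five. -/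
def symmetries₅ : List (List (List (ℕ × ℕ))) :=
  [[[], [(0, 0)]], [[], [(1, 1)]], [[], [(2, 2)]], [[], [(3, 3)]], [[], [(4, 4)]],
    [[], [(0, 4)], [(1, 4)], [(2, 4)], [(3, 4)]], [[], [(0, 3)], [(1, 3)], [(2, 3)]],
    [[], [(0, 2)], [(1, 2)]], [[], [(0, 1)]]]

/-- The admissible sets with six members in dimension four, up to automorphisms. -/
def classes₄ : List ℕ := [0x033c, 0x1668, 0x1686, 0x1698]

/-- The admissible sets with at least eleven members in dimension five, up to automorphisms, each
with some automorphisms that preserve it. No automorphisms are listed if the set is not the half of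
an admissible set with at least 21 members in dimension six. -/
def classes₅ : List (ℕ × List (List (ℕ × ℕ))) :=
  [(0x3cc0033c, []),
    (0x86611668, []),
    (0xa4431698, [
      [], [(1, 2), (3, 4), (3, 3), (4, 4)], [(1, 4), (2, 3), (3, 4), (0, 0), (1, 1), (4, 4)],
      [(1, 3), (2, 4), (3, 4), (0, 0), (2, 2), (4, 4)],
      [(0, 1), (2, 3), (0, 0), (1, 1), (2, 2), (3, 3)],
      [(0, 4), (1, 4), (2, 4), (2, 2), (3, 3), (4, 4)],
      [(0, 2), (1, 2), (2, 4), (3, 4), (0, 0), (1, 1), (3, 3), (4, 4)],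
      [(0, 3), (1, 3), (3, 4), (0, 0), (2, 2), (4, 4)],
      [(0, 1), (1, 3), (2, 3), (3, 4), (0, 0), (1, 1), (2, 2), (3, 3)],
      [(0, 4), (2, 4), (3, 4), (1, 1)], [(0, 3), (1, 2), (2, 3), (0, 0), (1, 1), (4, 4)],
      [(0, 2), (1, 4), (0, 0), (2, 2)], [(0, 1), (1, 4), (3, 4), (1, 1), (2, 2), (3, 3)],
      [(0, 3), (2, 4)], [(0, 2), (1, 3), (2, 3), (2, 2), (3, 3), (4, 4)],
      [(0, 4), (1, 2), (2, 3), (3, 4), (0, 0), (2, 2)],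
      [(0, 1), (1, 2), (2, 4), (1, 1), (2, 2), (3, 3)], [(0, 2), (2, 3), (3, 4), (1, 1)],
      [(0, 3), (1, 4), (2, 4), (3, 4), (3, 3), (4, 4)],
      [(0, 4), (1, 3), (0, 0), (1, 1), (3, 3), (4, 4)]]),
    (0x3c42013c, []),
    (0x3cc0013c, []),
    (0x64290358, [
      [], [(1, 2), (3, 4), (3, 3), (4, 4)], [(0, 1), (2, 3)],
      [(0, 2), (1, 2), (2, 4), (3, 4), (2, 2), (4, 4)],
      [(0, 1), (1, 3), (2, 3), (3, 4), (3, 3), (4, 4)], [(0, 2), (1, 4), (1, 1), (4, 4)],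
      [(0, 3), (2, 4), (2, 2), (4, 4)], [(0, 4), (1, 2), (2, 3), (3, 4), (0, 0), (4, 4)],
      [(0, 3), (1, 4), (2, 4), (3, 4), (1, 1), (4, 4)], [(0, 4), (1, 3), (0, 0), (4, 4)]]),
    (0x64830358, [
      [], [(1, 2), (3, 4), (3, 3), (4, 4)]]),
    (0x94260358, [
      [], [(0, 1), (2, 3)]]),
    (0x92490661, [])]

/-- Every admissible set with at least 21 members in dimension six is equivalent to one of
these. -/
def classes₆ : List ℕ :=
  [0x2c91614a52868934, 0x42a1921c38498562, 0x10c1942664298358, 0x1241942664298358,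
    0x4221921c38498562, 0x18426825a4164398, 0x508326842964c11a, 0x16a4c21818432568,
    0x04489483c1291a64, 0x20186843c21619a4, 0x0098a443c2251968, 0x21086843c21619a4,
    0x24086843c21619a4, 0x24886043c21619a4, 0x1088a443c2251968, 0x0241942664298358,
    0x24426818981643a4, 0x21426809981643a4, 0x24426809981643a4, 0x24422819981643a4,
    0x03645828141a26c1, 0x2948c12424831a94, 0x1868c20524431698, 0x88615224244a8691,
    0x6841241a18268394, 0x9218428581461c92, 0x8152612824864a91]

/-- Masks in dimension six with automorphisms that take them to members of `classes₆`. -/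
def table₆ : List (ℕ × List (ℕ × ℕ)) :=
  [(0xa44316981968c225, [(2, 4), (0, 0), (5, 5)]),
    (0xa44316980968c225, [(1, 3), (2, 2), (3, 3), (5, 5)]),
    (0xa44316980168c225, [(1, 3), (2, 2), (3, 3), (5, 5)]),
    (0xa44316980868c225, [(1, 2), (3, 4), (0, 0), (5, 5)]),
    (0xa44316981068c225, [(0, 2), (1, 3), (4, 5), (0, 0), (2, 2), (4, 4)]),
    (0xa44316980068c225, [(1, 3), (0, 0), (1, 1), (2, 2), (3, 3), (5, 5)]),
    (0xa44316981928c225, [(2, 5), (3, 3)]),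
    (0xa44316980928c225, [(0, 5), (1, 2), (0, 0), (5, 5)]),
    (0xa44316981128c225, [(1, 5), (2, 3), (0, 0), (1, 1), (2, 2), (3, 3)]),
    (0xa44316980128c225, [(0, 1), (1, 3), (0, 0), (5, 5)]),
    (0xa44316980828c225, [(0, 1), (1, 5), (0, 0), (5, 5)]),
    (0xa44316981028c225, [(0, 2), (1, 3), (4, 5), (0, 0), (2, 2), (4, 4)]),
    (0xa44316980148c225, [(1, 3), (4, 5), (0, 0), (4, 4)]),
    (0xa44316981048c225, [(0, 3), (1, 2), (2, 3), (1, 1), (3, 3), (5, 5)]),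
    (0xa44316980908c225, [(2, 3), (4, 5), (4, 4)]),
    (0xa44316981108c225, [(0, 0), (1, 1), (2, 2), (3, 3), (5, 5)]),
    (0xa44316980960c225, [(0, 2), (2, 3), (1, 1), (5, 5)]),
    (0xa44316980160c225, [(1, 3), (4, 5), (0, 0), (4, 4)]),
    (0xa44316980920c225, [(0, 1), (1, 3), (0, 0), (5, 5)]),
    (0xa44316980940c225, [(1, 3), (4, 5), (0, 0), (4, 4)]),
    (0xa443169818284225, [(1, 2), (3, 4), (5, 5)]),
    (0xa443169818484225, [(0, 2), (1, 2), (2, 4), (3, 4), (0, 0), (1, 1), (5, 5)]),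
    (0xa443169818604225, [(0, 3), (1, 3), (3, 4), (0, 0), (2, 2), (3, 3), (5, 5)]),
    (0xa443169809608225, [(0, 3), (1, 3), (3, 4), (0, 0), (2, 2), (3, 3), (5, 5)]),
    (0xa44316981928c025, [(0, 1), (0, 0), (4, 4), (5, 5)]),
    (0xa44316980928c025, [(1, 2), (2, 3), (1, 1), (2, 2), (3, 3), (5, 5)]),
    (0x642903581ac19426, [(0, 4), (1, 4), (2, 5), (4, 5), (2, 2)]),
    (0x642903580ac19426, [(0, 5), (2, 4), (3, 5), (2, 2), (3, 3)]),
    (0x6429035812c19426, [(0, 4), (2, 5), (3, 5), (4, 5), (2, 2)]),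
    (0x6429035802c19426, [(0, 5), (1, 4), (2, 4), (3, 5), (1, 1), (3, 3)]),
    (0x6429035808c19426, [(0, 5), (1, 4), (2, 4), (3, 5), (1, 1), (3, 3)]),
    (0x6429035810c19426, [(0, 2), (2, 5), (3, 4)]),
    (0x6429035812419426, [(0, 2), (1, 3), (2, 4), (3, 5), (0, 0), (1, 1), (2, 2), (3, 3)]),
    (0x6429035882419426, [(0, 5), (2, 5), (3, 4)]), (0x6429035818419426, [(0, 5), (3, 4)]),
    (0x6429035818819426, [(0, 3), (1, 5), (2, 3), (4, 5)]),
    (0x642903581ac09426, [(1, 4), (2, 5), (1, 1), (5, 5)]),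
    (0x642903580ac09426, [(0, 5), (3, 4), (4, 5), (2, 2), (4, 4)]),
    (0x6429035812c09426, [(0, 2), (2, 5), (1, 1), (2, 2), (3, 3)]),
    (0x642903581ac11426, [(1, 5), (2, 4), (1, 1)]),
    (0x642903580ac11426, [(1, 5), (2, 4), (3, 5), (0, 0), (1, 1)]),
    (0x6429035812c11426, [(0, 2), (2, 5), (3, 4), (4, 5), (1, 1), (2, 2), (3, 3)]),
    (0x642903581ac01426, [(1, 3), (2, 4), (2, 2), (5, 5)]),
    (0x6429035812c18426, [(0, 5), (1, 4), (2, 4), (3, 5), (1, 1), (3, 3)]),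
    (0x6483035818946824, [(0, 5), (3, 5), (4, 5), (0, 0), (2, 2), (5, 5)]),
    (0x942603581ac16429, [(1, 5), (2, 4), (3, 5), (0, 0)]),
    (0x942603580ac16429, [(0, 5), (1, 5), (2, 4), (3, 5), (0, 0), (1, 1)]),
    (0x9426035812c16429, [(0, 2), (2, 4), (3, 5), (0, 0)]),
    (0x9426035802c16429, [(0, 4), (1, 5), (2, 5), (3, 4), (4, 5), (0, 0), (3, 3)]),
    (0x9426035818c16429, [(0, 1), (1, 2), (2, 4), (3, 5), (0, 0), (1, 1)]),
    (0x9426035808c16429, [(0, 4), (2, 5), (3, 5), (0, 0), (3, 3)]),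
    (0x9426035810c16429, [(0, 5), (2, 4), (3, 4), (4, 5), (2, 2), (3, 3)]),
    (0x9426035812416429, [(0, 2), (1, 3), (2, 5), (3, 4), (4, 5), (0, 0), (1, 1)]),
    (0x9426035882416429, [(0, 4), (1, 4), (2, 4), (3, 5), (0, 0), (3, 3)]),
    (0x9426035818416429, [(0, 4), (3, 5), (4, 5), (0, 0), (3, 3)]),
    (0x9426035818816429, [(0, 2), (1, 2), (3, 5), (1, 1), (3, 3)]),
    (0x942603581ac06429, [(1, 5), (2, 4), (4, 5), (2, 2), (5, 5)]),
    (0x942603580ac06429, [(0, 4), (3, 5), (0, 0), (2, 2), (3, 3), (4, 4)]),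
    (0x9426035812c06429, [(0, 5), (2, 4), (3, 5), (1, 1), (3, 3), (4, 4)]),
    (0x9426035818c06429, [(0, 4), (1, 5), (2, 4), (3, 5), (0, 0), (2, 2), (3, 3), (4, 4)]),
    (0x942603581ac12429, [(0, 4), (1, 2), (2, 4), (3, 5), (0, 0), (3, 3)]),
    (0x942603580ac12429, [(1, 5), (2, 4), (3, 5), (4, 5), (2, 2), (3, 3)]),
    (0x9426035812c12429, [(0, 4), (1, 2), (2, 4), (3, 5), (0, 0), (3, 3)]),
    (0x9426035818c12429, [(0, 1), (1, 4), (3, 5), (0, 0), (2, 2)]),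
    (0x942603581a412429, [(0, 5), (1, 5), (2, 4), (4, 5), (2, 2), (3, 3)]),
    (0x942603581a812429, [(0, 5), (1, 5), (2, 4), (4, 5), (2, 2), (3, 3)]),
    (0x942603581ac02429, [(0, 4), (1, 3), (2, 4), (3, 4), (1, 1), (5, 5)]),
    (0x942603581ac10429, [(2, 5), (3, 4), (0, 0), (1, 1), (3, 3)]),
    (0x942603581ac16029, [(1, 4), (3, 5), (1, 1), (3, 3)]),
    (0x942603580ac16029, [(0, 2), (1, 4), (2, 5), (3, 5), (0, 0), (1, 1), (2, 2)]),
    (0x9426035812c16029, [(1, 4), (3, 5), (4, 5), (0, 0), (1, 1), (2, 2)]),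
    (0x9426035818c16029, [(0, 1), (1, 4), (3, 5), (0, 0), (2, 2)]),
    (0x942603581a416029, [(0, 2), (1, 2), (2, 4), (4, 5), (0, 0), (1, 1), (2, 2), (3, 3), (4, 4)]),
    (0x942603581a816029, [(0, 2), (1, 4), (3, 5), (4, 5), (0, 0), (1, 1), (2, 2)]),
    (0x942603581ac06029, [(0, 3), (1, 2), (2, 4), (0, 0), (2, 2), (5, 5)]),
    (0x942603581ac12029, [(1, 4), (3, 5), (0, 0), (3, 3)]),
    (0x942603581a41c029, [(0, 2), (1, 4), (2, 3), (0, 0), (1, 1), (5, 5)]),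
    (0x942603581ac14029, [(0, 1), (1, 5), (2, 5), (3, 5), (0, 0), (2, 2), (4, 4)]),
    (0x942603581ac16009, [(0, 3), (1, 2), (2, 3), (4, 5), (0, 0), (4, 4), (5, 5)]),
    (0x9426035892410ca1, [(0, 2), (1, 4), (2, 3), (5, 5)]),
    (0x942603581ac16421, [(0, 2), (1, 4), (2, 5), (4, 5), (1, 1), (3, 3)]),
    (0x942603580ac16421, [(0, 5), (1, 5), (2, 4)]),
    (0x9426035812c16421, [(0, 3), (1, 4), (2, 5), (3, 5), (4, 5), (0, 0), (1, 1), (2, 2)]),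
    (0x9426035818c16421, [(0, 1), (1, 4), (2, 5), (3, 5), (4, 5), (0, 0), (2, 2)]),
    (0x942603581ac06421, [(1, 5), (2, 4), (4, 5), (0, 0), (2, 2), (5, 5)]),
    (0x942603581ac12421, [(1, 5), (4, 5), (0, 0), (1, 1), (3, 3), (5, 5)]),
    (0x9426035818c16821, [(0, 1), (1, 5), (3, 4), (4, 5), (0, 0), (1, 1), (2, 2), (3, 3)]),
    (0x942603581ac16021, [(0, 5), (1, 2), (2, 5), (0, 0), (1, 1), (4, 4)]),
    (0x942603581ac16428, [(2, 3), (4, 5), (2, 2), (5, 5)]),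
    (0x942603580ac16428, [(0, 4), (2, 5), (4, 5), (1, 1), (5, 5)]),
    (0x9426035812c16428, [(0, 4), (1, 4), (2, 4), (3, 5), (2, 2), (3, 3), (4, 4)]),
    (0x9426035818c16428, [(0, 4), (1, 2), (3, 4), (1, 1), (5, 5)]),
    (0x942603581ac06428, [(1, 3), (2, 5), (4, 5), (0, 0), (1, 1), (2, 2), (3, 3), (4, 4), (5, 5)]),
    (0x942603581ac12428, [(0, 1), (1, 2), (3, 5), (4, 5), (0, 0), (1, 1), (3, 3), (5, 5)]),
    (0x942603581ac16028, [(1, 2), (2, 3), (4, 5), (2, 2), (4, 4), (5, 5)]),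
    (0x942603581ac16420, [(0, 3), (1, 5), (2, 3), (3, 5), (4, 5), (2, 2), (4, 4), (5, 5)])]

theorem search₄ : search (directions.take 4) 1 16 6 (anyImage symmetries₄ (mem classes₄)) 0 65535 =
    true := by
  decide +kernel

theorem equivalentTo_classes₄ {m : ℕ → Bool} (hm : Admissible 4 m) (h : 6 ≤ vertexCount m 16) :
    EquivalentTo 4 classes₄ m := by
  obtain ⟨L, hL, hpL, hLm⟩ := exists_mask_of_search₄ hm h search₄
  have hrec : Recognizes 4 classes₄ (anyImage symmetries₄ (mem classes₄)) :=
    (Recognizes.mem 4 classes₄).anyImage (by decide) (by decide)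
  exact (hrec L hL hpL).congr hLm

theorem searchAbove₄ : ∀ A ∈ classes₄,
    searchAbove 4 11 (anyImage symmetries₅ (mem (classes₅.map Prod.fst))) A = true := by
  decide +kernel

theorem searchAbove₅ : ∀ e ∈ classes₅,
    searchAbove 5 21 (anyWord e.2 (viaTable table₆ (mem classes₆))) e.1 = true := by
  decide +kernel

theorem searchAbove₆ : ∀ A ∈ classes₆, searchAbove 6 41 (fun _ => false) A = true := by
  decide +kernel

theorem equivalentTo_classes₅ {m : ℕ → Bool} (hm : Admissible 5 m) (h : 11 ≤ vertexCount m 32) :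
    EquivalentTo 5 (classes₅.map Prod.fst) m := by
  refine EquivalentTo.succ (k := 4) (by decide) (by decide) (half := 6) (target := 11) (by decide)
    (fun m => equivalentTo_classes₄) (fun A hA => ⟨?_, _, ?_, searchAbove₄ A hA⟩) hm h
  · revert A
    decide +kernel
  · exact (Recognizes.mem 5 _).anyImage (by decide) (by decide)

theorem equivalentTo_classes₆ {m : ℕ → Bool} (hm : Admissible 6 m) (h : 21 ≤ vertexCount m 64) :
    EquivalentTo 6 classes₆ m := by
  refine EquivalentTo.succ (k := 5) (by decide) (by decide) (half := 11) (target := 21) (by decide)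
    (fun m => equivalentTo_classes₅) (fun A hA => ?_) hm h
  obtain ⟨e, he, rfl⟩ := List.mem_map.1 hA
  have hlt : ∀ e ∈ classes₅, e.1 < 2 ^ 2 ^ 5 := by decide +kernel
  have hord : ∀ e ∈ classes₅, ∀ w ∈ e.2, OrderedBelow 6 w := by decide +kernel
  have htab : ∀ e ∈ table₆, OrderedBelow 6 e.2 := by decide +kernel
  exact ⟨hlt e he, _, ((Recognizes.mem 6 _).viaTable (by decide) htab).anyWord (by decide)
    (hord e he), searchAbove₅ e he⟩

theorem vertexCount_le_forty {m : ℕ → Bool} (hm : Admissible 7 m) : vertexCount m 128 ≤ 40 := by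
  by_contra hlt
  have hlt6 : ∀ A ∈ classes₆, A < 2 ^ 2 ^ 6 := by decide +kernel
  -- The searches above the members of `classes₆` find nothing.
  obtain ⟨_, _, A, hA, -⟩ : EquivalentTo 7 [] m :=
    EquivalentTo.succ (k := 6) (by decide) (by decide) (half := 21) (target := 41) (by decide)
      (fun m => equivalentTo_classes₆)
      (fun A hA => ⟨hlt6 A hA, _, Recognizes.const_false 7 [], searchAbove₆ A hA⟩) hm
      (not_le.1 hlt)
  simp at hA

/-! ### Values in small dimensions -/

theorem vertexCount_le_two {m : ℕ → Bool} (hm : Admissible 2 m) : vertexCount m 4 ≤ 2 := by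
  have h : ∀ z, m (z ^^^ 3) = true → m (z ^^^ 1) = false ∨ m (z ^^^ 2) = false := fun z hz => by
    simpa using hm z [0, 1] (by decide) (by decide) (by decide) hz
  have h0 := h 0
  have h1 := h 1
  have h2 := h 2
  have h3 := h 3
  norm_num at h0 h1 h2 h3
  simp only [vertexCount, Nat.count_succ, Nat.count_zero]
  revert h0 h1 h2 h3
  cases m 0 <;> cases m 1 <;> cases m 2 <;> cases m 3 <;> simp

theorem outerMutualVisibilityNumber_one_le :
    (hypercubeGraph 1).outerMutualVisibilityNumber ≤ 2 :=
  outerMutualVisibilityNumber_le fun M _ => (Set.ncard_le_card M).trans (by simp)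

theorem outerMutualVisibilityNumber_two_le :
    (hypercubeGraph 2).outerMutualVisibilityNumber ≤ 2 :=
  outerMutualVisibilityNumber_le fun _ => ncard_le_of_admissible fun _ => vertexCount_le_two

theorem outerMutualVisibilityNumber_four_le :
    (hypercubeGraph 4).outerMutualVisibilityNumber ≤ 6 :=
  outerMutualVisibilityNumber_le fun _ => ncard_le_of_admissible fun _ => vertexCount_le_six

theorem outerMutualVisibilityNumber_seven_le :
    (hypercubeGraph 7).outerMutualVisibilityNumber ≤ 40 :=
  outerMutualVisibilityNumber_le fun _ => ncard_le_of_admissible fun _ => vertexCount_le_forty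

theorem outerMutualVisibilityNumber_add_seven_le (d : ℕ) :
    (hypercubeGraph (7 + d)).outerMutualVisibilityNumber ≤ 40 * 2 ^ d := by
  induction d with
  | zero => exact outerMutualVisibilityNumber_seven_le
  | succ d ih =>
    refine (outerMutualVisibilityNumber_succ_le (7 + d)).trans ?_
    rw [pow_succ]
    omega

/-- In this and the following lemmas the binary digits of the mask list the members of an extremal
set. -/
theorem le_outerMutualVisibilityNumber_one :
    2 ≤ (hypercubeGraph 1).outerMutualVisibilityNumber :=
  le_outerMutualVisibilityNumber_of_mask (A := 0x3) (by decide +kernel) (by decide +kernel)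

theorem le_outerMutualVisibilityNumber_three :
    4 ≤ (hypercubeGraph 3).outerMutualVisibilityNumber :=
  le_outerMutualVisibilityNumber_of_mask (A := 0x3c) (by decide +kernel) (by decide +kernel)

theorem le_outerMutualVisibilityNumber_five :
    12 ≤ (hypercubeGraph 5).outerMutualVisibilityNumber :=
  le_outerMutualVisibilityNumber_of_mask (A := 0xa4431698) (by decide +kernel) (by decide +kernel)

theorem le_outerMutualVisibilityNumber_six :
    24 ≤ (hypercubeGraph 6).outerMutualVisibilityNumber :=
  le_outerMutualVisibilityNumber_of_mask (A := 0x1968c225a4431698) (by decide +kernel)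
    (by decide +kernel)

theorem le_outerMutualVisibilityNumber_seven :
    40 ≤ (hypercubeGraph 7).outerMutualVisibilityNumber :=
  le_outerMutualVisibilityNumber_of_mask (A := 0xa55050000aa5a5500aa5a550000a0aa5)
    (by decide +kernel) (by decide +kernel)

end CubeVisibility

open CubeVisibility in
theorem mainTheorem6 :
    ((hypercubeGraph 1).outerMutualVisibilityNumber = 2 ∧
      (hypercubeGraph 2).outerMutualVisibilityNumber = 2 ∧
      (hypercubeGraph 3).outerMutualVisibilityNumber = 4 ∧
      (hypercubeGraph 4).outerMutualVisibilityNumber = 6 ∧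
      (hypercubeGraph 5).outerMutualVisibilityNumber = 12 ∧
      (hypercubeGraph 6).outerMutualVisibilityNumber = 24 ∧
      (hypercubeGraph 7).outerMutualVisibilityNumber = 40) ∧
    ∀ h : ℕ, 8 ≤ h →
      h.choose (h / 2) ≤ (hypercubeGraph h).outerMutualVisibilityNumber ∧
      (hypercubeGraph h).outerMutualVisibilityNumber ≤ 40 * 2 ^ (h - 7) := by
  have h2 := outerMutualVisibilityNumber_two_le
  have h3 : (hypercubeGraph 3).outerMutualVisibilityNumber ≤ _ :=
    outerMutualVisibilityNumber_succ_le 2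
  have h4 := outerMutualVisibilityNumber_four_le
  have h5 : (hypercubeGraph 5).outerMutualVisibilityNumber ≤ _ :=
    outerMutualVisibilityNumber_succ_le 4
  have h6 : (hypercubeGraph 6).outerMutualVisibilityNumber ≤ _ :=
    outerMutualVisibilityNumber_succ_le 5
  refine ⟨⟨le_antisymm outerMutualVisibilityNumber_one_le le_outerMutualVisibilityNumber_one,
    le_antisymm h2 (choose_le_outerMutualVisibilityNumber 2 1),
    le_antisymm (by omega) le_outerMutualVisibilityNumber_three,
    le_antisymm h4 (choose_le_outerMutualVisibilityNumber 4 2),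
    le_antisymm (by omega) le_outerMutualVisibilityNumber_five,
    le_antisymm (by omega) le_outerMutualVisibilityNumber_six,
    le_antisymm outerMutualVisibilityNumber_seven_le le_outerMutualVisibilityNumber_seven⟩,
    fun h hh => ⟨choose_le_outerMutualVisibilityNumber h (h / 2), ?_⟩⟩
  obtain ⟨d, rfl⟩ := Nat.exists_eq_add_of_le (show 7 ≤ h by omega)
  rw [Nat.add_sub_cancel_left]
  exact outerMutualVisibilityNumber_add_seven_le d
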